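/- **Setting.** Let $\mathcal K\subseteq[0,1]^d$ be a closed convex set that is down-closed ($\mathbf 0\le \mathbf x\le \mathbf y\in\mathcal K$ implies $\mathbf x\in\mathcal K$), has more than one point, and let $\mathbf c\in\mathcal K$ and $r>0$ be such that every point of $\mathrm{aff}(\mathcal K)$ at Euclidean distance at most $r$ from $\mathbf c$ lies in $\mathcal K$. Put $\mathcal L_0=\mathrm{aff}(\mathcal K)-\mathbf c$ and $k=\dim\mathcal L_0$. Let $f_1,\dots,f_T:[0,1]^d\to\mathbb R_{\ge0}$ be a fixed sequence of differentiable DR-submodular functions ($\mathbf x\le\mathbf y$ in $[0,1]^d$ implies $\nabla f_t(\mathbf x)\ge\nabla f_t(\mathbf y)$ coordinatewise; no monotonicity is assumed) with $\|\nabla f_t\|\le M_1$ on $\mathcal K$. In round $t$ the player plays one action $\hat{\mathbf x}_t\in\mathcal K$ and makes one query, at a point $\mathbf q_t\in\mathcal K$, to a stochastic value oracle, which returns $o_t$ with $|o_t|\le B_0$ and conditional mean $f_t(\mathbf q_t)$, given the past and the player's samples of round $t$. **Algorithm (FOTZO applied to SO-OGA with BQND).** Fix $v>0$. Let $\delta=T^{-1/4}$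 (the smoothing radius), $\varphi(\mathbf x)=(1-\delta/r)(\mathbf x-\mathbf c)+\mathbf c$, $\hat{\mathcal K}=\varphi(\mathcal K)$, $\hat r=r-\delta$, $\epsilon=vT^{-1/2}$, $B_1=\frac k\delta B_0$ and $\eta=\frac{v\hat r}{2B_1}T^{-1/2}$; assume that $T\ge 1$ is so large that $\delta<r$ and $\epsilon<\hat r$. Let a measurable separation oracle for $\hat{\mathcal K}$ be given, which returns for each $\mathbf y\notin\hat{\mathcal K}$ a vector $\mathbf g$ with $\langle\mathbf g,\mathbf y-\mathbf x\rangle>0$ for all $\mathbf x\in\hat{\mathcal K}$. For $z\in[0,1]$ let $h_z(\mathbf x)=\mathbf 1-e^{-z\mathbf x}$ (coordinatewise). Start with $\mathbf x_1=\mathbf c$. In round $t$: 1. Let $\boldsymbol\xi_t=\varphi^{-1}(\mathbf x_t)\in\mathcal K$ and play $\hat{\mathbf x}_t=\varphi(h_1(\boldsymbol\xi_t))$. 2. Independently of each other and of the past, sample $z_t\in[0,1]$ with density $\frac{e^{z-1}}{1-e^{-1}}$ and $\mathbf u_t$ uniformly on the unit sphere of $\mathcal L_0$. Query the value oracle at $\mathbf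 q_t=\varphi(h_{z_t}(\boldsymbol\xi_t))+\delta\mathbf u_t$, receive $o_t$, and put $\mathbf g_t=\left(\tfrac k\delta o_t\mathbf u_t\right)\odot e^{-z_t\boldsymbol\xi_t}$. 3. Let $\mathbf x_{t+1}$ be the infeasible projection of $\mathbf x_t+\eta\mathbf g_t$, obtained as follows: project on $\mathrm{aff}(\hat{\mathcal K})$, then on the ball of $\mathrm{aff}(\hat{\mathcal K})$ with centre $\mathbf c$ and radius $\mathrm{diam}(\hat{\mathcal K})$; then, as long as the current point $\mathbf y$ is not in $\hat{\mathcal K}$, replace it by $\mathbf y-\epsilon\,\mathbf g'/\|\mathbf g'\|$, where $\mathbf g'$ is the orthogonal projection on $\mathcal L_0$ of the vector that the separation oracle returns at $\mathbf y$. **Claim.** The algorithm is well defined: almost surely all actions and all query points lie in $\mathcal K$, and each $f_t(\hat{\mathbf x}_t)$ is integrable. There is a constant $C$, depending only on $d$, $r$, $v$, $M_1$ and $B_0$, such that for all such $T$, all such $\mathcal K$, $\mathbf c$ and separation oracles, and all such functions and value oracles, $$\frac1e\max_{\mathbf y\in\mathcal K}\sum_{t=1}^Tf_t(\mathbf y)-\sum_{t=1}^T\mathbb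 E[f_t(\hat{\mathbf x}_t)]\le C\,T^{3/4}$$ and $$\max_{1\le a\le b\le T}\left\{\frac1e\max_{\mathbf y\in\mathcal K}\sum_{t=a}^bf_t(\mathbf y)-\sum_{t=a}^b\mathbb E[f_t(\hat{\mathbf x}_t)]\right\}\le C\,T^{3/4}.$$ -/

import Mathlib

open MeasureTheory ProbabilityTheory

noncomputable section

namespace DRSub

/-! ### Vectors, constraint sets and objective functions -/

/-- `ℝ^d` with the Euclidean norm. -/
abbrev Vec (d : ℕ) := EuclideanSpace ℝ (Fin d)

/-- The cube `[0,1]^d`. -/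
def unitCube (d : ℕ) : Set (Vec d) := {x | ∀ i, 0 ≤ x i ∧ x i ≤ 1}

/-- `0 ≤ x ≤ y` and `y ∈ K` imply `x ∈ K`. -/
def IsDownClosed {d : ℕ} (K : Set (Vec d)) : Prop :=
  ∀ y ∈ K, ∀ x : Vec d, (∀ i, 0 ≤ x i ∧ x i ≤ y i) → x ∈ K

/-- `f : [0,1]^d → ℝ_{≥ 0}` is non-negative, differentiable and DR-submodular (its gradient `g` is
antitone on the cube; no monotonicity of `f` is required), and `‖∇ f‖ ≤ M₁` on `K`.
The values of `f` outside the cube play no role. -/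
def IsDRSubmodular {d : ℕ} (K : Set (Vec d)) (M₁ : ℝ) (f : Vec d → ℝ) : Prop :=
  (∀ x ∈ unitCube d, 0 ≤ f x) ∧
  ∃ g : Vec d → Vec d,
    (∀ x ∈ unitCube d, HasGradientWithinAt f (g x) (unitCube d) x) ∧
    (∀ x ∈ unitCube d, ∀ y ∈ unitCube d, (∀ i, x i ≤ y i) → ∀ i, g y i ≤ g x i) ∧
    (∀ x ∈ K, ‖g x‖ ≤ M₁)

/-! ### The shrunk domain -/

/-- The affine map `x ↦ (1 - δ / r) (x - c) + c`. -/
def shrink {d : ℕ} (c : Vec d) (r δ : ℝ) (x : Vec d) : Vec d := (1 - δ / r) • (x - c) + c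

/-- The inverse of `shrink c r δ` (for `δ < r`). -/
def unshrink {d : ℕ} (c : Vec d) (r δ : ℝ) (x : Vec d) : Vec d := (1 - δ / r)⁻¹ • (x - c) + c

/-- The shrunk domain `{(1 - δ / r) (x - c) + c | x ∈ K}`. -/
def shrunkSet {d : ℕ} (K : Set (Vec d)) (c : Vec d) (r δ : ℝ) : Set (Vec d) :=
  shrink c r δ '' K

/-! ### Infeasible projection and online gradient ascent via a separation oracle (SO-OGA) -/

/-- A (Borel measurable) separation oracle: at every `y ∉ D` it returns a vector `g` with
`⟪g, y - x⟫ > 0` for all `x ∈ D`. -/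
def IsSeparationOracle {d : ℕ} (D : Set (Vec d)) (so : Vec d → Vec d) : Prop :=
  Measurable so ∧ ∀ y, y ∉ D → ∀ x ∈ D, 0 < inner ℝ (so y) (y - x)

/-- One pass through the loop of the infeasible projection:
`y ↦ y - ε g' / ‖g'‖`, with `g'` the projection of the separating vector on `aff D - c`. -/
def soipStep {d : ℕ} (D : Set (Vec d)) (so : Vec d → Vec d) (ε : ℝ) (y : Vec d) : Vec d :=
  y - (ε / ‖(vectorSpan ℝ D).starProjection (so y)‖) • (vectorSpan ℝ D).starProjection (so y)

/-- The starting point of the loop: `y₀` is projected on `aff D` (this gives `y₁`; here `c ∈ D`),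
then on the ball of `aff D` with centre `c` and radius `diam D`. -/
def soipStart {d : ℕ} (D : Set (Vec d)) (c y₀ : Vec d) : Vec d :=
  let y₁ := c + (vectorSpan ℝ D).starProjection (y₀ - c)
  c + (max 1 (‖y₁ - c‖ / Metric.diam D))⁻¹ • (y₁ - c)

/-- The infeasible projection SO-IP: the first point of the loop that lies in `D`. -/
def soip {d : ℕ} (D : Set (Vec d)) (c : Vec d) (so : Vec d → Vec d) (ε : ℝ) (y₀ : Vec d) : Vec d :=
  (soipStep D so ε)^[sInf {n : ℕ | (soipStep D so ε)^[n] (soipStart D c y₀) ∈ D}]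
    (soipStart D c y₀)

/-- The update of SO-OGA on the domain `D` with step size `η` and shrinking parameter `ε`:
a gradient ascent step along `g`, then the infeasible projection. -/
def soogaStep {d : ℕ} (D : Set (Vec d)) (c : Vec d) (so : Vec d → Vec d) (ε η : ℝ)
    (x g : Vec d) : Vec d :=
  soip D c so ε (x + η • g)

/-! ### The query algorithm BQND -/

/-- `h_z(x) = 1 - e^{-z x}`, coordinatewise. -/
def hMap {d : ℕ} (z : ℝ) (x : Vec d) : Vec d := WithLp.toLp 2 fun i => 1 - Real.exp (-(z * x i))

/-- `g ⊙ e^{-z x}`, coordinatewise. -/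
def expScale {d : ℕ} (z : ℝ) (x g : Vec d) : Vec d :=
  WithLp.toLp 2 fun i => g i * Real.exp (-(z * x i))

/-- The sampling law of `z` in BQND: density `e^{z - 1} / (1 - e^{-1})` on `[0,1]`. -/
def bqndLaw : Measure ℝ :=
  (volume.restrict (Set.Icc (0 : ℝ) 1)).withDensity
    fun z => ENNReal.ofReal (Real.exp (z - 1) / (1 - Real.exp (-1)))

/-- The map `h_z` on the shrunk domain, which is identified with `K` through `shrink c r δ`. -/
def hShrunk {d : ℕ} (c : Vec d) (r δ z : ℝ) (x : Vec d) : Vec d :=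
  shrink c r δ (hMap z (unshrink c r δ x))

/-- The output of BQND on the shrunk domain, at the point `x`, when `z` was sampled and the
first-order oracle returned `g`. -/
def bqndOutput {d : ℕ} (c : Vec d) (r δ z : ℝ) (x g : Vec d) : Vec d :=
  expScale z (unshrink c r δ x) g

/-! ### FOTZO applied to SO-OGA with BQND -/

/-- The uniform distribution on the unit sphere of the linear subspace `L₀`. -/
def uniformSphere {d : ℕ} (L₀ : Submodule ℝ (Vec d)) : Measure (Vec d) :=
  ((volume : Measure L₀).toSphere Set.univ)⁻¹ •
    ((volume : Measure L₀).toSphere).map fun u : Metric.sphere (0 : L₀) 1 => ((u : L₀) : Vec d)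

/-- The input of the algorithm: constraint set `K`, centre `c`, radius `r`, bound `B₀` on the output
of the value oracle, constant `v` of SO-OGA, horizon `T`, and a separation oracle `so` (for the
shrunk domain, on which SO-OGA is run). -/
structure Input (d : ℕ) where
  K : Set (Vec d)
  c : Vec d
  r : ℝ
  B₀ : ℝ
  v : ℝ
  T : ℕ
  so : Vec d → Vec d

namespace Input

variable {d : ℕ} (p : Input d)

/-- The smoothing radius `δ = T^{-1/4}` of FOTZO. -/
def δ : ℝ := (p.T : ℝ) ^ (-(1 / 4) : ℝ)

/-- The shrunk domain, passed to SO-OGA and BQND. -/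
def dom : Set (Vec d) := shrunkSet p.K p.c p.r p.δ

/-- The linear space `L₀ = aff K - c`. -/
def L₀ : Submodule ℝ (Vec d) := vectorSpan ℝ p.K

/-- `k = dim L₀`. -/
def k : ℕ := Module.finrank ℝ p.L₀

/-- The radius of the ball around `c` in the shrunk domain: `(1 - δ / r) r = r - δ`. -/
def rDom : ℝ := p.r - p.δ

/-- The bound `B₁ = (k / δ) B₀` on the gradient estimates. -/
def B₁ : ℝ := p.k / p.δ * p.B₀

/-- The shrinking parameter `v T^{-1/2}` of SO-OGA. -/
def ε : ℝ := p.v * (p.T : ℝ) ^ (-(1 / 2) : ℝ)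

/-- The step size `v r / (2 B₁) T^{-1/2}` of SO-OGA, for the radius of the shrunk domain. -/
def η : ℝ := p.v * p.rDom / (2 * p.B₁) * (p.T : ℝ) ^ (-(1 / 2) : ℝ)

/-- The points `x_t` of SO-OGA, for given samples `z`, `u` and given answers `o` of the value
oracle. FOTZO hands `(k / δ) o_t u_t` to BQND as the answer of a first-order oracle, and the output
of BQND is handed to SO-OGA. Rounds are numbered `0, …, T - 1`. -/
def iter (z : ℕ → ℝ) (u : ℕ → Vec d) (o : ℕ → ℝ) : ℕ → Vec d
  | 0 => p.c
  | t + 1 =>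
    soogaStep p.dom p.c p.so p.ε p.η (iter z u o t)
      (bqndOutput p.c p.r p.δ (z t) (iter z u o t) ((p.k / p.δ * o t) • u t))

/-- The action played in round `t`: `h(x_t)`, with `h = h_1` on the shrunk domain. -/
def action (z : ℕ → ℝ) (u : ℕ → Vec d) (o : ℕ → ℝ) (t : ℕ) : Vec d :=
  hShrunk p.c p.r p.δ 1 (p.iter z u o t)

/-- The point at which the value oracle is queried in round `t`: the query point `h_{z_t}(x_t)` of
BQND, perturbed by `δ u_t`. -/
def query (z : ℕ → ℝ) (u : ℕ → Vec d) (o : ℕ → ℝ) (t : ℕ) : Vec d :=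
  hShrunk p.c p.r p.δ (z t) (p.iter z u o t) + p.δ • u t

end Input

/-! ### Runs of the algorithm and regret -/

section Runs

variable {d : ℕ} {Ω : Type*} [MeasurableSpace Ω]

/-- The random action of round `t`. -/
def actionRV (p : Input d) (Z : ℕ → Ω → ℝ) (U : ℕ → Ω → Vec d) (O : ℕ → Ω → ℝ)
    (t : ℕ) (ω : Ω) : Vec d :=
  p.action (fun s => Z s ω) (fun s => U s ω) (fun s => O s ω) t

/-- The random query point of round `t`. -/
def queryRV (p : Input d) (Z : ℕ → Ω → ℝ) (U : ℕ → Ω → Vec d) (O : ℕ → Ω → ℝ)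
    (t : ℕ) (ω : Ω) : Vec d :=
  p.query (fun s => Z s ω) (fun s => U s ω) (fun s => O s ω) t

/-- The σ-algebra of the samples of round `t`. -/
abbrev sampleSigma (Z : ℕ → Ω → ℝ) (U : ℕ → Ω → Vec d) (t : ℕ) : MeasurableSpace Ω :=
  MeasurableSpace.comap (fun ω => (Z t ω, U t ω)) inferInstance

/-- The σ-algebra of all samples and oracle answers before round `t`. -/
abbrev pastSigma (Z : ℕ → Ω → ℝ) (U : ℕ → Ω → Vec d) (O : ℕ → Ω → ℝ) (t : ℕ) :
    MeasurableSpace Ω :=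
  ⨆ s, ⨆ _ : s < t, MeasurableSpace.comap (fun ω => (Z s ω, U s ω, O s ω)) inferInstance

/-- `Z`, `U`, `O` are the samples of BQND, the samples of FOTZO and the answers of the value oracles
in a run of the algorithm against the fixed sequence `f`: in each round `z_t` and `u_t` are drawn
from their laws, independently of each other and of the past, and the stochastic value oracle is
bounded by `B₀` and unbiased at the query point. -/
structure IsRun (p : Input d) (f : ℕ → Vec d → ℝ) (P : Measure Ω)
    (Z : ℕ → Ω → ℝ) (U : ℕ → Ω → Vec d) (O : ℕ → Ω → ℝ) : Prop where
  measurable_Z : ∀ t < p.T, Measurable (Z t)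
  measurable_U : ∀ t < p.T, Measurable (U t)
  measurable_O : ∀ t < p.T, Measurable (O t)
  law : ∀ t < p.T,
    P.map (fun ω => (Z t ω, U t ω)) = bqndLaw.prod (uniformSphere p.L₀)
  indep : ∀ t < p.T, Indep (sampleSigma Z U t) (pastSigma Z U O t) P
  bounded : ∀ t < p.T, ∀ᵐ ω ∂P, |O t ω| ≤ p.B₀
  unbiased : ∀ t < p.T,
    P[O t | pastSigma Z U O t ⊔ sampleSigma Z U t] =ᵐ[P] fun ω => f t (queryRV p Z U O t ω)

/-- The expected `α`-regret over the rounds in `I`, where `X t` is the (random) action of round `t`: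
`α max_{y ∈ K} ∑_{t ∈ I} f_t(y) - ∑_{t ∈ I} E[f_t(X_t)]`. -/
def regret (α : ℝ) (K : Set (Vec d)) (f : ℕ → Vec d → ℝ) (P : Measure Ω)
    (X : ℕ → Ω → Vec d) (I : Finset ℕ) : ℝ :=
  α * sSup ((fun y => ∑ t ∈ I, f t y) '' K) - ∑ t ∈ I, ∫ ω, f t (X t ω) ∂P

/-- The static `α`-regret over the horizon `T`. -/
def staticRegret (α : ℝ) (K : Set (Vec d)) (f : ℕ → Vec d → ℝ) (P : Measure Ω)
    (X : ℕ → Ω → Vec d) (T : ℕ) : ℝ :=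
  regret α K f P X (Finset.range T)

/-- The adaptive `α`-regret: the supremum of the regret over all intervals of rounds. -/
def adaptiveRegret (α : ℝ) (K : Set (Vec d)) (f : ℕ → Vec d → ℝ) (P : Measure Ω)
    (X : ℕ → Ω → Vec d) (T : ℕ) : ℝ :=
  sSup {R : ℝ | ∃ s e : ℕ, s ≤ e ∧ e < T ∧ R = regret α K f P X (Finset.Icc s e)}

end Runs

end DRSub

end

/-!
Along `h_z` a DR-submodular function satisfies
`e⁻¹ f(y) - f(h_1(x)) ≤ ∫₀¹ e^{z-1} ⟪∇f(h_z(x)) ⊙ e^{-z x}, y - x⟫ dz`, so for the sampled `z_t` the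
regret is at most a linear regret, up to the factor `1 - e⁻¹`. By the divergence theorem,
`(k / δ) f(q + δ u) u` with `u` uniform on the unit sphere of `L₀` has the mean `E ∇f(q + δ b)`, for
`b` uniform on the unit ball of `L₀`. For fixed `b` the map `x ↦ f(φ(x) + δ b)` is again
DR-submodular on the cube wherever its values are used, so the inequality above is applied for
each `b` separately and then averaged. It remains to bound the linear regret of SO-OGA: the
infeasible projection does not increase the distance to a point of the shrunk domain whose
`ε`-neighbourhood lies in that domain, since every separating direction separates this whole
neighbourhood; hence the usual telescoping of squared distances goes through, over any interval of
rounds. With the given parameters every error term is of order `T^{3/4}`.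
-/

noncomputable section

namespace DRSub

section Divergence

open Metric Set Filter Topology Module
open scoped NNReal

section Cone

variable {E : Type*} [NormedAddCommGroup E] {s t : ℝ} {x : E}

/-- The cone of height `s` over the ball of radius `s`. Its derivative in `s` is the indicator of
that ball, so that differentiating an integration by parts against `cone s` with respect to `s`
yields the divergence theorem on the ball. -/
def cone (s : ℝ) (x : E) : ℝ := max 0 (s - ‖x‖)

theorem cone_of_norm_le (h : ‖x‖ ≤ s) : cone s x = s - ‖x‖ := max_eq_right (sub_nonneg.2 h)

theorem cone_of_le_norm (h : s ≤ ‖x‖) : cone s x = 0 := max_eq_left (sub_nonpos.2 h)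

theorem abs_cone_sub_cone_le (s t : ℝ) (x : E) : |cone s x - cone t x| ≤ |s - t| := by
  simpa [cone, max_comm (0 : ℝ)] using abs_max_sub_max_le_abs (s - ‖x‖) (t - ‖x‖) 0

theorem lipschitzWith_cone (s : ℝ) : LipschitzWith 1 (cone s : E → ℝ) :=
  (LipschitzWith.of_dist_le_mul fun x y => by
    simpa [Real.dist_eq, dist_eq_norm, norm_sub_rev y] using
      abs_norm_sub_norm_le y x).const_max 0

theorem hasCompactSupport_cone [ProperSpace E] (s : ℝ) : HasCompactSupport (cone s : E → ℝ) :=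
  .of_support_subset_isCompact (isCompact_closedBall 0 s) fun x hx => by
    by_contra hlt
    exact hx (cone_of_le_norm (not_le.1 (mem_closedBall_zero_iff.not.1 hlt)).le)

theorem hasDerivAt_cone (hxs : ‖x‖ ≠ s) :
    HasDerivAt (fun t => cone t x) ((ball (0 : E) s).indicator 1 x) s := by
  rcases hxs.lt_or_gt with hlt | hgt
  · rw [indicator_of_mem (mem_ball_zero_iff.2 hlt)]
    refine ((hasDerivAt_id s).sub_const ‖x‖).congr_of_eventuallyEq ?_
    filter_upwards [Ioi_mem_nhds hlt] with t ht using cone_of_norm_le (mem_Ioi.1 ht).le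
  · rw [indicator_of_notMem (mem_ball_zero_iff.not.2 hgt.not_gt)]
    refine (hasDerivAt_const s (0 : ℝ)).congr_of_eventuallyEq ?_
    filter_upwards [Iio_mem_nhds hgt] with t ht using cone_of_le_norm (mem_Iio.1 ht).le

theorem hasLineDerivAt_norm {E : Type*} [NormedAddCommGroup E] [InnerProductSpace ℝ E] {x : E}
    (hx : x ≠ 0) (v : E) : HasLineDerivAt ℝ norm (inner ℝ x v / ‖x‖) x v := by
  have hline : HasDerivAt (fun t : ℝ => x + t • v) v 0 := by
    simpa using ((hasDerivAt_id (0 : ℝ)).smul_const v).const_add x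
  have hsqrt := hline.norm_sq.sqrt (by simpa using hx)
  simp only [Real.sqrt_sq (norm_nonneg _), zero_smul, add_zero] at hsqrt
  exact hsqrt.congr_deriv (mul_div_mul_left _ _ two_ne_zero)

theorem lineDeriv_cone {E : Type*} [NormedAddCommGroup E] [InnerProductSpace ℝ E] {x : E}
    (hx : x ≠ 0) (hxs : ‖x‖ ≠ s) (v : E) :
    lineDeriv ℝ (cone s) x v = -(ball (0 : E) s).indicator (fun y => inner ℝ y v / ‖y‖) x := by
  have hcont : Tendsto (fun t : ℝ => ‖x + t • v‖) (𝓝 0) (𝓝 ‖x‖) := by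
    have : ContinuousAt (fun t : ℝ => ‖x + t • v‖) 0 := by fun_prop
    simpa [ContinuousAt] using this
  rcases hxs.lt_or_gt with hlt | hgt
  · rw [indicator_of_mem (mem_ball_zero_iff.2 hlt)]
    refine ((HasDerivAt.const_sub s (hasLineDerivAt_norm hx v)).congr_of_eventuallyEq ?_).deriv
    filter_upwards [hcont.eventually_lt_const hlt] with t ht using cone_of_norm_le ht.le
  · rw [indicator_of_notMem (mem_ball_zero_iff.not.2 hgt.not_gt), neg_zero]
    refine ((hasDerivAt_const (0 : ℝ) (0 : ℝ)).congr_of_eventuallyEq ?_).deriv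
    filter_upwards [hcont.eventually_const_lt hgt] with t ht using cone_of_le_norm ht.le

end Cone

section Polar

variable {E F : Type*} [NormedAddCommGroup E] [NormedSpace ℝ E] [FiniteDimensional ℝ E]
  [MeasurableSpace E] [BorelSpace E] [Nontrivial E] [NormedAddCommGroup F] [NormedSpace ℝ F]
  (μ : Measure E) [μ.IsAddHaarMeasure]

theorem integral_eq_integral_sphere {h : E → F} (hh : Integrable h μ) :
    ∫ x, h x ∂μ =
      ∫ s in Ioi (0 : ℝ), s ^ (finrank ℝ E - 1) • ∫ u, h (s • (u : E)) ∂μ.toSphere := by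
  have hpolar := μ.measurePreserving_homeomorphUnitSphereProd
  have hemb := (homeomorphUnitSphereProd E).measurableEmbedding
  let g : sphere (0 : E) 1 × Ioi (0 : ℝ) → F := fun p => h ((p.2 : ℝ) • (p.1 : E))
  have hg : g ∘ homeomorphUnitSphereProd E = fun x : ({(0)}ᶜ : Set E) => h x := by
    ext x
    simp [g, smul_smul, norm_ne_zero_iff.2 x.2]
  have hg_int : Integrable g (μ.toSphere.prod (.volumeIoiPow (finrank ℝ E - 1))) := by
    rw [← hpolar.integrable_comp_emb hemb, hg]
    exact (integrableOn_iff_comap_subtypeVal (measurableSet_singleton (0 : E)).compl).1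
      hh.integrableOn
  calc
    ∫ x, h x ∂μ = ∫ x : ({(0)}ᶜ : Set E), h x ∂(μ.comap (↑)) := by
      rw [integral_subtype_comap (measurableSet_singleton _).compl fun x ↦ h x,
        restrict_compl_singleton]
    _ = ∫ p, g p ∂μ.toSphere.prod (.volumeIoiPow (finrank ℝ E - 1)) := by
      rw [← hpolar.integral_comp hemb, ← hg]
      rfl
    _ = ∫ s : Ioi (0 : ℝ), ∫ u, h ((s : ℝ) • (u : E)) ∂μ.toSphere
          ∂.volumeIoiPow (finrank ℝ E - 1) := integral_prod_symm _ hg_int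
    _ = _ := by
      simp only [Measure.volumeIoiPow, ENNReal.ofReal]
      rw [integral_withDensity_eq_integral_smul
          (measurable_subtype_coe.pow_const _).real_toNNReal,
        integral_subtype_comap measurableSet_Ioi fun a ↦ Real.toNNReal (a ^ (finrank ℝ E - 1)) •
          ∫ u, h (a • (u : E)) ∂μ.toSphere]
      refine setIntegral_congr_fun measurableSet_Ioi fun a ha => ?_
      simp only [NNReal.smul_def, Real.coe_toNNReal _ (pow_nonneg (mem_Ioi.1 ha).le _)]

theorem setIntegral_ball_eq_integral_sphere {h : E → F} {s : ℝ} (hs : 0 ≤ s)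
    (hh : IntegrableOn h (ball 0 s) μ) :
    ∫ x in ball 0 s, h x ∂μ =
      ∫ a in (0 : ℝ)..s, a ^ (finrank ℝ E - 1) • ∫ u, h (a • (u : E)) ∂μ.toSphere := by
  rw [← integral_indicator measurableSet_ball,
    integral_eq_integral_sphere μ (hh.integrable_indicator measurableSet_ball),
    intervalIntegral.integral_of_le hs, integral_Ioc_eq_integral_Ioo,
    ← integral_indicator measurableSet_Ioi, ← integral_indicator measurableSet_Ioo]
  congr 1 with a
  rcases le_or_gt a 0 with ha | ha
  · simp [ha.not_gt, indicator]
  have hmem : ∀ u : sphere (0 : E) 1, a • (u : E) ∈ ball (0 : E) s ↔ a < s := fun u => by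
    simp [norm_smul, abs_of_pos ha]
  by_cases has : a < s <;> simp [ha, has, hmem, indicator]

end Polar

variable {E : Type*} [NormedAddCommGroup E] [InnerProductSpace ℝ E] [FiniteDimensional ℝ E]
  [MeasurableSpace E] [BorelSpace E] [Nontrivial E] (μ : Measure E) [μ.IsAddHaarMeasure]

theorem ae_norm_ne (s : ℝ) : ∀ᵐ x ∂μ, ‖x‖ ≠ s := by
  simpa using measure_eq_zero_iff_ae_notMem.1 (Measure.addHaar_sphere μ 0 s)

theorem integral_lineDeriv_mul_cone {C : ℝ≥0} {f : E → ℝ} (hf : LipschitzWith C f) (v : E)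
    (s : ℝ) :
    ∫ x, lineDeriv ℝ f x v * cone s x ∂μ = ∫ x in ball 0 s, inner ℝ x v / ‖x‖ * f x ∂μ := by
  rw [hf.integral_lineDeriv_mul_eq (lipschitzWith_cone s) (hasCompactSupport_cone s),
    ← integral_indicator measurableSet_ball]
  refine integral_congr_ae ?_
  filter_upwards [ae_norm_ne μ 0, ae_norm_ne μ s] with x hx hxs
  rw [lineDeriv_cone (norm_ne_zero_iff.1 hx) hxs]
  by_cases hm : x ∈ ball (0 : E) s <;> simp [hm, neg_div]

theorem hasDerivAt_integral_mul_cone {g : E → ℝ} (hg : AEStronglyMeasurable g μ) {B : ℝ}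
    (hB : ∀ x, |g x| ≤ B) (s : ℝ) :
    HasDerivAt (fun t => ∫ x, g x * cone t x ∂μ) (∫ x in ball 0 s, g x ∂μ) s := by
  have hcone : ∀ t, Continuous (cone t : E → ℝ) := fun t => (lipschitzWith_cone t).continuous
  have hlip : ∀ x, LipschitzOnWith
      (Real.nnabs ((ball (0 : E) (s + 1)).indicator (fun _ => B) x))
      (fun t => g x * cone t x) (Iio (s + 1)) := by
    refine fun x => .of_dist_le_mul fun a ha b hb => ?_
    by_cases hx : x ∈ ball (0 : E) (s + 1)
    · rw [indicator_of_mem hx, Real.coe_nnabs, Real.dist_eq, ← mul_sub, abs_mul]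
      exact mul_le_mul ((hB x).trans (le_abs_self B)) (abs_cone_sub_cone_le a b x)
        (abs_nonneg _) (abs_nonneg _)
    · have hx' : s + 1 ≤ ‖x‖ := by simpa using hx
      rw [cone_of_le_norm ((mem_Iio.1 ha).le.trans hx'),
        cone_of_le_norm ((mem_Iio.1 hb).le.trans hx'), dist_self]
      positivity
  have hderiv : ∀ᵐ x ∂μ, HasDerivAt (fun t => g x * cone t x) ((ball 0 s).indicator g x) s := by
    filter_upwards [ae_norm_ne μ s] with x hx
    refine ((hasDerivAt_cone hx).const_mul (g x)).congr_deriv ?_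
    by_cases hm : x ∈ ball (0 : E) s <;> simp [hm]
  rw [← integral_indicator measurableSet_ball]
  exact (hasDerivAt_integral_of_dominated_loc_of_lip (Iio_mem_nhds (lt_add_one s))
    (.of_forall fun t => hg.mul (hcone t).aestronglyMeasurable)
    (((hcone s).integrable_of_hasCompactSupport (hasCompactSupport_cone s)).bdd_mul hg
      (.of_forall hB))
    (hg.indicator measurableSet_ball) (.of_forall hlip)
    ((integrable_indicator_iff measurableSet_ball).2
      (integrableOn_const measure_ball_lt_top.ne)) hderiv).2

theorem setIntegral_ball_inner_div_norm_mul {f : E → ℝ} (hf : Continuous f) (v : E) {s : ℝ}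
    (hs : 0 ≤ s) :
    ∫ x in ball 0 s, inner ℝ x v / ‖x‖ * f x ∂μ =
      ∫ a in (0 : ℝ)..s, a ^ (finrank ℝ E - 1) *
        ∫ u, inner ℝ (u : E) v * f (a • (u : E)) ∂μ.toSphere := by
  have hbdd : ∀ x : E, ‖inner ℝ x v / ‖x‖‖ ≤ ‖v‖ := fun x => by
    rw [norm_div, norm_norm]
    exact div_le_of_le_mul₀ (norm_nonneg x) (norm_nonneg v)
      (mul_comm ‖x‖ ‖v‖ ▸ norm_inner_le_norm x v)
  have hint : IntegrableOn (fun x => inner ℝ x v / ‖x‖ * f x) (ball 0 s) μ :=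
    Integrable.bdd_mul
      ((hf.continuousOn.integrableOn_compact (isCompact_closedBall 0 s)).mono_set
        ball_subset_closedBall)
      (Measurable.aestronglyMeasurable (by fun_prop)) (.of_forall hbdd)
  rw [setIntegral_ball_eq_integral_sphere μ hs hint]
  refine intervalIntegral.integral_congr_ae (.of_forall fun a ha => ?_)
  have ha : 0 < a := (uIoc_of_le hs ▸ ha).1
  simp [norm_smul, abs_of_pos ha, inner_smul_left, mul_div_cancel_left₀, ha.ne']

theorem hasDerivAt_setIntegral_ball_inner_div_norm_mul {f : E → ℝ} (hf : Continuous f) (v : E)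
    {s : ℝ} (hs : 0 < s) :
    HasDerivAt (fun t => ∫ x in ball 0 t, inner ℝ x v / ‖x‖ * f x ∂μ)
      (s ^ (finrank ℝ E - 1) * ∫ u, inner ℝ (u : E) v * f (s • (u : E)) ∂μ.toSphere) s := by
  have hcont : Continuous fun a : ℝ => a ^ (finrank ℝ E - 1) *
      ∫ u, inner ℝ (u : E) v * f (a • (u : E)) ∂μ.toSphere := by
    refine (continuous_pow _).mul ?_
    simpa using continuous_parametric_integral_of_continuous (μ := μ.toSphere)
      (f := fun (a : ℝ) (u : sphere (0 : E) 1) => inner ℝ (u : E) v * f (a • (u : E)))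
      (by fun_prop) isCompact_univ
  refine (intervalIntegral.integral_hasDerivAt_right (hcont.intervalIntegrable 0 s)
    (hcont.stronglyMeasurableAtFilter _ _) hcont.continuousAt).congr_of_eventuallyEq ?_
  filter_upwards [Ioi_mem_nhds hs] with t ht using
    setIntegral_ball_inner_div_norm_mul μ hf v (mem_Ioi.1 ht).le

theorem setIntegral_ball_lineDeriv {C : ℝ≥0} {f : E → ℝ} (hf : LipschitzWith C f) (v : E)
    {s : ℝ} (hs : 0 < s) :
    ∫ x in ball 0 s, lineDeriv ℝ f x v ∂μ =
      s ^ (finrank ℝ E - 1) * ∫ u, inner ℝ (u : E) v * f (s • (u : E)) ∂μ.toSphere := by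
  have hcone := hasDerivAt_integral_mul_cone μ
    (measurable_lineDeriv (v := v) hf.continuous).aestronglyMeasurable
    (fun x => norm_lineDeriv_le_of_lipschitz ℝ hf) s
  simp only [integral_lineDeriv_mul_cone μ hf v] at hcone
  exact hcone.unique (hasDerivAt_setIntegral_ball_inner_div_norm_mul μ hf.continuous v hs)

end Divergence

section DRSubmodular

variable {d : ℕ}

theorem convex_unitCube (d : ℕ) : Convex ℝ (unitCube d) := by
  intro x hx y hy a b ha hb hab i
  have hxi := hx i
  have hyi := hy i
  simp only [PiLp.add_apply, PiLp.smul_apply, smul_eq_mul]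
  constructor <;> nlinarith

theorem inner_le_inner_of_le {a b v : Vec d} (hab : ∀ i, a i ≤ b i) (hv : ∀ i, 0 ≤ v i) :
    inner ℝ a v ≤ inner ℝ b v := by
  simp only [PiLp.inner_apply, RCLike.inner_apply, conj_trivial]
  exact Finset.sum_le_sum fun i _ => mul_le_mul_of_nonneg_left (hab i) (hv i)

/-- `F` is a non-negative DR-submodular function on the cube and `G` is its gradient. This is
`IsDRSubmodular` with the gradient made explicit and without the bound on it. -/
structure HasDRGradient (F : Vec d → ℝ) (G : Vec d → Vec d) : Prop where
  nonneg : ∀ x ∈ unitCube d, 0 ≤ F x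
  grad : ∀ x ∈ unitCube d, HasGradientWithinAt F (G x) (unitCube d) x
  anti : ∀ x ∈ unitCube d, ∀ y ∈ unitCube d, (∀ i, x i ≤ y i) → ∀ i, G y i ≤ G x i

namespace HasDRGradient

variable {F : Vec d → ℝ} {G : Vec d → Vec d} {x y v w : Vec d} {θ z : ℝ}

theorem hasDerivWithinAt_comp (h : HasDRGradient F G) {γ : ℝ → Vec d} {γ' : Vec d} {s : Set ℝ}
    {t : ℝ} (ht : t ∈ s) (hγ : HasDerivWithinAt γ γ' s t) (hs : ∀ a ∈ s, γ a ∈ unitCube d) :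
    HasDerivWithinAt (fun a => F (γ a)) (inner ℝ (G (γ t)) γ') s t :=
  (h.grad (γ t) (hs t ht)).hasFDerivWithinAt.comp_hasDerivWithinAt t hγ hs

theorem exists_sub_eq_inner (h : HasDRGradient F G) (hx : x ∈ unitCube d)
    (hxv : x + v ∈ unitCube d) :
    ∃ t ∈ Set.Ioo (0 : ℝ) 1, F (x + v) - F x = inner ℝ (G (x + t • v)) v := by
  have hderiv : ∀ t ∈ Set.Icc (0 : ℝ) 1, HasDerivWithinAt (fun a : ℝ => F (x + a • v))
      (inner ℝ (G (x + t • v)) v) (Set.Icc 0 1) t := fun t ht =>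
    h.hasDerivWithinAt_comp (γ := fun a : ℝ => x + a • v) ht
      (by simpa using (((hasDerivAt_id t).smul_const v).const_add x).hasDerivWithinAt)
      fun a ha => (convex_unitCube d).add_smul_mem hx hxv ha
  obtain ⟨t, ht, hslope⟩ := exists_hasDerivAt_eq_slope (fun a : ℝ => F (x + a • v))
    (fun t => inner ℝ (G (x + t • v)) v) zero_lt_one
    (fun t ht => (hderiv t ht).continuousWithinAt)
    (fun t ht => (hderiv t (Set.Ioo_subset_Icc_self ht)).hasDerivAt (Icc_mem_nhds ht.1 ht.2))
  exact ⟨t, ht, by simpa using hslope.symm⟩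

theorem inner_le_sub (h : HasDRGradient F G) (hx : x ∈ unitCube d) (hxv : x + v ∈ unitCube d)
    (hv : ∀ i, 0 ≤ v i) : inner ℝ (G (x + v)) v ≤ F (x + v) - F x := by
  obtain ⟨t, ht, hmean⟩ := h.exists_sub_eq_inner hx hxv
  have hmem := (convex_unitCube d).add_smul_mem hx hxv (Set.Ioo_subset_Icc_self ht)
  rw [hmean]
  exact inner_le_inner_of_le (h.anti _ hmem _ hxv fun i => by
    simpa using mul_le_of_le_one_left (hv i) ht.2.le) hv

theorem sub_le_inner (h : HasDRGradient F G) (hx : x ∈ unitCube d) (hxv : x + v ∈ unitCube d)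
    (hv : ∀ i, 0 ≤ v i) : F (x + v) - F x ≤ inner ℝ (G x) v := by
  obtain ⟨t, ht, hmean⟩ := h.exists_sub_eq_inner hx hxv
  have hmem := (convex_unitCube d).add_smul_mem hx hxv (Set.Ioo_subset_Icc_self ht)
  rw [hmean]
  exact inner_le_inner_of_le (h.anti _ hx _ hmem fun i => by
    simpa using mul_nonneg ht.1.le (hv i)) hv

theorem mul_le_apply_add_smul (h : HasDRGradient F G) (hθ : θ ∈ Set.Icc (0 : ℝ) 1)
    (hx : x ∈ unitCube d) (hxv : x + v ∈ unitCube d) (hv : ∀ i, 0 ≤ v i) :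
    (1 - θ) * F x ≤ F (x + θ • v) := by
  have hθ' : 0 ≤ 1 - θ := sub_nonneg.2 hθ.2
  have hmem : x + θ • v ∈ unitCube d := (convex_unitCube d).add_smul_mem hx hxv hθ
  have hsplit : x + θ • v + (1 - θ) • v = x + v := by module
  have hfirst := h.inner_le_sub hx hmem fun i => by simpa using mul_nonneg hθ.1 (hv i)
  have hlast := h.sub_le_inner hmem (hsplit ▸ hxv) fun i => by simpa using mul_nonneg hθ' (hv i)
  rw [hsplit] at hlast
  rw [inner_smul_right] at hfirst hlast
  have hend := mul_nonneg hθ.1 (h.nonneg _ hxv)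
  linarith [mul_le_mul_of_nonneg_left hfirst hθ', mul_le_mul_of_nonneg_left hlast hθ.1]

theorem mul_le_apply_of_sub_le (h : HasDRGradient F G) (hθ : θ ∈ Set.Icc (0 : ℝ) 1)
    (hx : x ∈ unitCube d) (hxw : ∀ i, x i ≤ w i) (hwx : ∀ i, w i - x i ≤ θ * (1 - x i)) :
    (1 - θ) * F x ≤ F w := by
  rcases hθ.1.eq_or_lt with rfl | hθ0
  · have hw : w = x := by
      ext i
      linarith [hxw i, hwx i]
    simp [hw]
  have hv : ∀ i, 0 ≤ (θ⁻¹ • (w - x)) i := fun i =>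
    mul_nonneg (inv_nonneg.2 hθ0.le) (sub_nonneg.2 (hxw i))
  have hv' : ∀ i, (θ⁻¹ • (w - x)) i ≤ 1 - x i := fun i => (inv_mul_le_iff₀ hθ0).2 (hwx i)
  have hmul := h.mul_le_apply_add_smul (v := θ⁻¹ • (w - x)) hθ hx
    (fun i => ⟨add_nonneg (hx i).1 (hv i), le_sub_iff_add_le'.1 (hv' i)⟩) hv
  rwa [smul_inv_smul₀ hθ0.ne', add_sub_cancel] at hmul

theorem comp_homothety (h : HasDRGradient F G) {a : ℝ} (ha : a ∈ Set.Icc (0 : ℝ) 1)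
    {b : Vec d} (hb : b ∈ unitCube d) :
    HasDRGradient (fun x => F (a • x + (1 - a) • b))
      (fun x => a • G (a • x + (1 - a) • b)) := by
  have hmem : ∀ x ∈ unitCube d, a • x + (1 - a) • b ∈ unitCube d := fun x hx =>
    convex_unitCube d hx hb ha.1 (sub_nonneg.2 ha.2) (by ring)
  refine ⟨fun x hx => h.nonneg _ (hmem x hx), fun x hx => ?_, fun x hx y hy hxy i => ?_⟩
  · have hinner : HasFDerivWithinAt (fun x : Vec d => a • x + (1 - a) • b)
        (a • ContinuousLinearMap.id ℝ (Vec d)) (unitCube d) x :=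
      (((hasFDerivAt_id x).const_smul a).add_const _).hasFDerivWithinAt
    rw [hasGradientWithinAt_iff_hasFDerivWithinAt]
    refine ((h.grad _ (hmem x hx)).hasFDerivWithinAt.comp x hinner hmem).congr_fderiv ?_
    ext w
    simp
  · have hanti := h.anti _ (hmem x hx) _ (hmem y hy) (fun i => by
      simpa using mul_le_mul_of_nonneg_left (hxy i) ha.1) i
    simpa using mul_le_mul_of_nonneg_left hanti ha.1

end HasDRGradient

end DRSubmodular

section BQND

variable {d : ℕ} {x y : Vec d} {z : ℝ}

@[simp] theorem hMap_apply (z : ℝ) (x : Vec d) (i : Fin d) :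
    hMap z x i = 1 - Real.exp (-(z * x i)) := rfl

@[simp] theorem expScale_apply (z : ℝ) (x g : Vec d) (i : Fin d) :
    expScale z x g i = g i * Real.exp (-(z * x i)) := rfl

theorem expScale_sub (z : ℝ) (x g g' : Vec d) :
    expScale z x (g - g') = expScale z x g - expScale z x g' := by
  ext i; simp [sub_mul]

theorem expScale_smul (z a : ℝ) (x g : Vec d) :
    expScale z x (a • g) = a • expScale z x g := by
  ext i; simp [mul_assoc]

theorem exp_neg_mul_le_one (hz : 0 ≤ z) (hx : x ∈ unitCube d) (i : Fin d) :
    Real.exp (-(z * x i)) ≤ 1 :=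
  Real.exp_le_one_iff.2 (neg_nonpos.2 (mul_nonneg hz (hx i).1))

theorem hMap_mem_unitCube (hz : 0 ≤ z) (hx : x ∈ unitCube d) : hMap z x ∈ unitCube d := fun i =>
  ⟨sub_nonneg.2 (exp_neg_mul_le_one hz hx i), sub_le_self 1 (Real.exp_pos _).le⟩

theorem hMap_apply_le (hz : z ≤ 1) {i : Fin d} (hx : 0 ≤ x i) : hMap z x i ≤ x i := by
  have hexp := Real.add_one_le_exp (-(z * x i))
  have hmul : z * x i ≤ x i := mul_le_of_le_one_left hx hz
  simp only [hMap_apply]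
  linarith

theorem hMap_add_expScale_mem_unitCube (hz : 0 ≤ z) (hx : x ∈ unitCube d)
    (hy : y ∈ unitCube d) : hMap z x + expScale z x y ∈ unitCube d := fun i => by
  have hexp := mul_le_of_le_one_left (Real.exp_pos (-(z * x i))).le (hy i).2
  refine ⟨add_nonneg (hMap_mem_unitCube hz hx i).1 (mul_nonneg (hy i).1 (Real.exp_pos _).le), ?_⟩
  simp only [PiLp.add_apply, hMap_apply, expScale_apply]
  linarith

theorem hasDerivAt_hMap (x : Vec d) (z : ℝ) :
    HasDerivAt (fun z => hMap z x) (expScale z x x) z := by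
  have hpi : HasDerivAt (fun (z : ℝ) i => 1 - Real.exp (-(z * x i)))
      (fun i => x i * Real.exp (-(z * x i))) z := hasDerivAt_pi.2 fun i => by
    simpa [mul_comm] using ((((hasDerivAt_id z).mul_const (x i)).neg).exp).const_sub 1
  exact (PiLp.continuousLinearEquiv 2 ℝ fun _ : Fin d => ℝ).symm.hasFDerivAt.comp_hasDerivAt z hpi

@[fun_prop]
theorem continuous_hMap {α : Type*} [TopologicalSpace α] {z : α → ℝ} {x : α → Vec d}
    (hz : Continuous z) (hx : Continuous x) : Continuous fun a => hMap (z a) (x a) := by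
  unfold hMap
  fun_prop

@[fun_prop]
theorem continuous_expScale {α : Type*} [TopologicalSpace α] {z : α → ℝ} {x g : α → Vec d}
    (hz : Continuous z) (hx : Continuous x) (hg : Continuous g) :
    Continuous fun a => expScale (z a) (x a) (g a) := by
  unfold expScale
  fun_prop

theorem norm_expScale_le (hz : 0 ≤ z) (hx : x ∈ unitCube d) (g : Vec d) :
    ‖expScale z x g‖ ≤ ‖g‖ := by
  rw [EuclideanSpace.norm_eq, EuclideanSpace.norm_eq]
  refine Real.sqrt_le_sqrt (Finset.sum_le_sum fun i _ => ?_)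
  rw [expScale_apply, norm_mul, Real.norm_of_nonneg (Real.exp_pos _).le]
  gcongr
  exact mul_le_of_le_one_right (norm_nonneg _) (exp_neg_mul_le_one hz hx i)

theorem inner_expScale_left (z : ℝ) (x g w : Vec d) :
    inner ℝ (expScale z x g) w = inner ℝ g (expScale z x w) := by
  simp only [PiLp.inner_apply, expScale_apply, RCLike.inner_apply, conj_trivial]
  exact Finset.sum_congr rfl fun i _ => by ring

namespace HasDRGradient

variable {F : Vec d → ℝ} {G : Vec d → Vec d}

theorem exp_neg_mul_le_apply_hMap_add_expScale (h : HasDRGradient F G) (hz : 0 ≤ z)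
    (hx : x ∈ unitCube d) (hy : y ∈ unitCube d) :
    Real.exp (-z) * F y ≤ F (hMap z x + expScale z x y) := by
  have hθ : 1 - Real.exp (-z) ∈ Set.Icc (0 : ℝ) 1 :=
    ⟨sub_nonneg.2 (Real.exp_le_one_iff.2 (neg_nonpos.2 hz)), sub_le_self 1 (Real.exp_pos _).le⟩
  have hle := h.mul_le_apply_of_sub_le (w := hMap z x + expScale z x y) hθ hy ?_ ?_
  · rwa [sub_sub_cancel] at hle
  all_goals
    intro i
    have hy' : 0 ≤ 1 - y i := sub_nonneg.2 (hy i).2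
    simp only [PiLp.add_apply, hMap_apply, expScale_apply]
  · linarith [mul_nonneg (sub_nonneg.2 (exp_neg_mul_le_one hz hx i)) hy']
  · have hexp : Real.exp (-z) ≤ Real.exp (-(z * x i)) :=
      Real.exp_le_exp.2 (neg_le_neg (mul_le_of_le_one_right hz (hx i).2))
    linarith [mul_le_mul_of_nonneg_right hexp hy']

theorem exp_neg_one_mul_le (h : HasDRGradient F G) (hz : 0 ≤ z)
    (hx : x ∈ unitCube d) (hy : y ∈ unitCube d) :
    Real.exp (-1) * F y ≤
      Real.exp (z - 1) * (F (hMap z x) + inner ℝ (G (hMap z x)) (expScale z x y)) := by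
  have hfirst := h.sub_le_inner (hMap_mem_unitCube hz hx)
    (hMap_add_expScale_mem_unitCube hz hx hy) fun i => mul_nonneg (hy i).1 (Real.exp_pos _).le
  have hexp : Real.exp (-1) = Real.exp (z - 1) * Real.exp (-z) := by
    rw [← Real.exp_add]
    ring_nf
  rw [hexp, mul_assoc]
  gcongr
  linarith [h.exp_neg_mul_le_apply_hMap_add_expScale hz hx hy]

/-- The right-hand side of `exp_neg_one_mul_le` is the integrand below plus the derivative of
`e ^ (z - 1) * F (h_z x)`. -/
theorem exp_neg_one_mul_sub_le (h : HasDRGradient F G) (hx : x ∈ unitCube d)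
    (hy : y ∈ unitCube d)
    (hint : IntegrableOn (fun z => Real.exp (z - 1) *
      inner ℝ (G (hMap z x)) (expScale z x (y - x))) (Set.Icc 0 1)) :
    Real.exp (-1) * F y - F (hMap 1 x) ≤
      ∫ z in (0 : ℝ)..1, Real.exp (z - 1) * inner ℝ (G (hMap z x)) (expScale z x (y - x)) := by
  set Φ := fun z => Real.exp (z - 1) * inner ℝ (G (hMap z x)) (expScale z x (y - x))
  have hderiv : ∀ z ∈ Set.Icc (0 : ℝ) 1, HasDerivWithinAt
      (fun z => Real.exp (z - 1) * F (hMap z x))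
      (Real.exp (z - 1) * F (hMap z x) +
        Real.exp (z - 1) * inner ℝ (G (hMap z x)) (expScale z x x)) (Set.Icc 0 1) z := by
    intro z hz
    have hexp : HasDerivAt (fun z : ℝ => Real.exp (z - 1)) (Real.exp (z - 1)) z := by
      simpa using ((hasDerivAt_id z).sub_const 1).exp
    exact hexp.hasDerivWithinAt.mul (h.hasDerivWithinAt_comp hz
      (hasDerivAt_hMap x z).hasDerivWithinAt fun a ha => hMap_mem_unitCube ha.1 hx)
  have hle : ∀ z ∈ Set.Ioo (0 : ℝ) 1, Real.exp (-1) * F y - Φ z ≤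
      Real.exp (z - 1) * F (hMap z x) +
        Real.exp (z - 1) * inner ℝ (G (hMap z x)) (expScale z x x) := fun z hz => by
    simp only [Φ, expScale_sub, inner_sub_right]
    linarith [h.exp_neg_one_mul_le hz.1.le hx hy]
  have hftc := intervalIntegral.integral_le_sub_of_hasDeriv_right_of_le
    (φ := fun z => Real.exp (-1) * F y - Φ z) zero_le_one
    (fun z hz => (hderiv z hz).continuousWithinAt)
    (fun z hz => ((hderiv z (Set.Ioo_subset_Icc_self hz)).hasDerivAt
      (Icc_mem_nhds hz.1 hz.2)).hasDerivWithinAt)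
    ((integrableOn_const (by simp)).sub hint) hle
  rw [intervalIntegral.integral_sub (by simp)
    ((intervalIntegrable_iff_integrableOn_Icc_of_le zero_le_one).2 hint)] at hftc
  simp only [intervalIntegral.integral_const, sub_zero, one_smul, sub_self, Real.exp_zero,
    one_mul, zero_sub] at hftc
  have hstart := mul_nonneg (Real.exp_pos (-1)).le (h.nonneg _ (hMap_mem_unitCube le_rfl hx))
  linarith

end HasDRGradient

end BQND

section InfeasibleProjection

theorem norm_inv_max_one_smul_sub_le {E : Type*} [NormedAddCommGroup E] [InnerProductSpace ℝ E]
    {w q : E} {R : ℝ} (hR : 0 < R) (hq : ‖q‖ ≤ R) :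
    ‖(max 1 (‖w‖ / R))⁻¹ • w - q‖ ≤ ‖w - q‖ := by
  rcases le_total (‖w‖ / R) 1 with hin | hout
  · rw [max_eq_left hin, inv_one, one_smul]
  rw [max_eq_right hout, inv_div]
  have hRw : R ≤ ‖w‖ := (one_le_div hR).1 hout
  have hw : 0 < ‖w‖ := hR.trans_le hRw
  set s := R / ‖w‖ with hs
  have hs0 : 0 ≤ s := by positivity
  have hs1 : 0 ≤ 1 - s := sub_nonneg.2 ((div_le_one hw).2 hRw)
  have hinner : inner ℝ w q ≤ ‖w‖ * (s * ‖w‖) := by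
    rw [hs, div_mul_cancel₀ _ hw.ne']
    exact (real_inner_le_norm w q).trans (mul_le_mul_of_nonneg_left hq hw.le)
  rw [← sq_le_sq₀ (norm_nonneg _) (norm_nonneg _), norm_sub_sq_real, norm_sub_sq_real,
    inner_smul_left, norm_smul, Real.norm_of_nonneg hs0, conj_trivial]
  linarith [mul_le_mul_of_nonneg_left hinner hs1,
    mul_nonneg hs1 (mul_nonneg hs1 (sq_nonneg ‖w‖))]

variable {d : ℕ} {D : Set (Vec d)} {c x y q : Vec d} {so : Vec d → Vec d} {ε : ℝ}

/-- `y` is at distance at least `ε` from the relative boundary of `D`: the `ε`-ball around `y` in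
the affine hull of `D` lies in `D`. -/
def IsDeep (D : Set (Vec d)) (ε : ℝ) (y : Vec d) : Prop :=
  y ∈ D ∧ ∀ w ∈ vectorSpan ℝ D, ‖w‖ ≤ ε → y + w ∈ D

theorem sub_mem_vectorSpan (hx : x ∈ D) (hy : y ∈ D) : x - y ∈ vectorSpan ℝ D :=
  vsub_mem_vectorSpan ℝ hx hy

theorem soipStart_sub_mem (D : Set (Vec d)) (c y : Vec d) :
    soipStart D c y - c ∈ vectorSpan ℝ D := by
  simp only [soipStart, add_sub_cancel_left]
  exact Submodule.smul_mem _ _ (Submodule.starProjection_apply_mem _ _)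

theorem norm_soipStart_sub_le (hD : Bornology.IsBounded D) (hDn : D.Nontrivial) (hc : c ∈ D)
    (hq : q ∈ D) : ‖soipStart D c y - q‖ ≤ ‖y - q‖ := by
  set L := vectorSpan ℝ D
  have hqc : ‖q - c‖ ≤ Metric.diam D := dist_eq_norm q c ▸ Metric.dist_le_diam_of_mem hD hq hc
  have hproj : L.starProjection (y - q) = L.starProjection (y - c) - (q - c) := by
    rw [← sub_sub_sub_cancel_right y q c, map_sub,
      Submodule.starProjection_eq_self_iff.2 (sub_mem_vectorSpan hq hc)]
  calc ‖soipStart D c y - q‖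
      = ‖(max 1 (‖L.starProjection (y - c)‖ / Metric.diam D))⁻¹ • L.starProjection (y - c)
          - (q - c)‖ := by
        simp only [soipStart, add_sub_cancel_left]
        congr 1
        abel
    _ ≤ ‖L.starProjection (y - c) - (q - c)‖ :=
        norm_inv_max_one_smul_sub_le (Metric.diam_pos hDn hD) hqc
    _ ≤ ‖y - q‖ := hproj ▸ Submodule.norm_starProjection_apply_le L _

theorem soipStep_sub_mem (so : Vec d → Vec d) (ε : ℝ) (hy : y - c ∈ vectorSpan ℝ D) :
    soipStep D so ε y - c ∈ vectorSpan ℝ D := by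
  rw [soipStep, sub_right_comm]
  exact Submodule.sub_mem _ hy (Submodule.smul_mem _ _ (Submodule.starProjection_apply_mem _ _))

theorem soipStep_iterate_sub_mem (so : Vec d → Vec d) (ε : ℝ) (hy : y - c ∈ vectorSpan ℝ D)
    (n : ℕ) : (soipStep D so ε)^[n] y - c ∈ vectorSpan ℝ D := by
  induction n with
  | zero => simpa using hy
  | succ n ih =>
    rw [Function.iterate_succ_apply']
    exact soipStep_sub_mem so ε ih

/-- The separating direction still separates the deep point moved by `ε` along it, so the step
gains `ε` in that direction. -/
theorem norm_soipStep_sub_sq_le (hso : IsSeparationOracle D so) (hε : 0 ≤ ε) (hc : c ∈ D)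
    (hq : IsDeep D ε q) (hyc : y - c ∈ vectorSpan ℝ D) (hy : y ∉ D) :
    ‖soipStep D so ε y - q‖ ^ 2 ≤ ‖y - q‖ ^ 2 - ε ^ 2 := by
  set L := vectorSpan ℝ D
  set g := L.starProjection (so y) with hg
  have hsep : ∀ x ∈ D, 0 < inner ℝ g (y - x) := fun x hx => by
    have hyx : y - x ∈ L := by simpa using add_mem hyc (sub_mem_vectorSpan hc hx)
    rw [hg, Submodule.inner_starProjection_left_eq_right,
      Submodule.starProjection_eq_self_iff.2 hyx]
    exact hso.2 y hy x hx
  have hg0 : 0 < ‖g‖ := norm_pos_iff.2 fun h => by simpa [h] using hsep c hc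
  have hnorm : ‖(ε / ‖g‖) • g‖ = ε := by
    rw [norm_smul, Real.norm_of_nonneg (by positivity), div_mul_cancel₀ _ hg0.ne']
  have hmoved := hsep _ (hq.2 _
    (Submodule.smul_mem _ (ε / ‖g‖) (Submodule.starProjection_apply_mem _ _)) hnorm.le)
  rw [← hg, ← sub_sub, inner_sub_right, inner_smul_right, real_inner_self_eq_norm_sq] at hmoved
  have hgain : ε * ε ≤ ε / ‖g‖ * inner ℝ g (y - q) := calc
    ε * ε = ε / ‖g‖ * (ε / ‖g‖ * ‖g‖ ^ 2) := by field_simp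
    _ ≤ ε / ‖g‖ * inner ℝ g (y - q) := by gcongr; linarith
  rw [soipStep, sub_right_comm, norm_sub_sq_real, inner_smul_right, real_inner_comm, hnorm]
  linarith

theorem norm_soipStep_iterate_sub_sq_le (hso : IsSeparationOracle D so) (hε : 0 ≤ ε)
    (hc : c ∈ D) (hq : IsDeep D ε q) (hy : y - c ∈ vectorSpan ℝ D) (n : ℕ)
    (hn : ∀ m < n, (soipStep D so ε)^[m] y ∉ D) :
    ‖(soipStep D so ε)^[n] y - q‖ ^ 2 ≤ ‖y - q‖ ^ 2 - n * ε ^ 2 := by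
  induction n with
  | zero => simp
  | succ n ih =>
    rw [Function.iterate_succ_apply']
    have hstep := norm_soipStep_sub_sq_le hso hε hc hq (soipStep_iterate_sub_mem so ε hy n)
      (hn n n.lt_succ_self)
    push_cast
    linarith [ih fun m hm => hn m (hm.trans n.lt_succ_self)]

theorem exists_soipStep_iterate_mem (hso : IsSeparationOracle D so) (hε : 0 < ε) (hc : c ∈ D)
    (hq : IsDeep D ε q) (hy : y - c ∈ vectorSpan ℝ D) : ∃ n, (soipStep D so ε)^[n] y ∈ D := by
  by_contra! hout
  obtain ⟨n, hn⟩ := exists_nat_gt (‖y - q‖ ^ 2 / ε ^ 2)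
  have hle := norm_soipStep_iterate_sub_sq_le hso hε.le hc hq hy n fun m _ => hout m
  rw [div_lt_iff₀ (by positivity)] at hn
  linarith [sq_nonneg ‖(soipStep D so ε)^[n] y - q‖]

theorem soip_mem (hso : IsSeparationOracle D so) (hε : 0 < ε) (hc : c ∈ D) (hq : IsDeep D ε q)
    (y : Vec d) : soip D c so ε y ∈ D :=
  Nat.sInf_mem (s := {n | (soipStep D so ε)^[n] (soipStart D c y) ∈ D})
    (exists_soipStep_iterate_mem hso hε hc hq (soipStart_sub_mem D c y))

theorem norm_soip_sub_le (hD : Bornology.IsBounded D) (hDn : D.Nontrivial)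
    (hso : IsSeparationOracle D so) (hε : 0 ≤ ε) (hc : c ∈ D) (hq : IsDeep D ε q) (y : Vec d) :
    ‖soip D c so ε y - q‖ ≤ ‖y - q‖ := by
  refine le_trans ?_ (norm_soipStart_sub_le hD hDn hc hq.1)
  refine (sq_le_sq₀ (norm_nonneg _) (norm_nonneg _)).1 ?_
  exact (norm_soipStep_iterate_sub_sq_le hso hε hc hq (soipStart_sub_mem D c y) _
    fun m hm => Nat.notMem_of_lt_sInf hm).trans (sub_le_self _ (by positivity))

theorem measurable_soipStep (D : Set (Vec d)) (hso : Measurable so) (ε : ℝ) :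
    Measurable (soipStep D so ε) := by
  have hproj : Measurable fun y => (vectorSpan ℝ D).starProjection (so y) :=
    (vectorSpan ℝ D).starProjection.continuous.measurable.comp hso
  unfold soipStep
  fun_prop

theorem measurable_soipStart (D : Set (Vec d)) (c : Vec d) : Measurable (soipStart D c) := by
  have hproj : Measurable fun y : Vec d => (vectorSpan ℝ D).starProjection (y - c) :=
    (vectorSpan ℝ D).starProjection.continuous.measurable.comp (by fun_prop)
  unfold soipStart
  simp only [add_sub_cancel_left]
  fun_prop

theorem measurable_soip (hD : MeasurableSet D) (hso : IsSeparationOracle D so) (hε : 0 < ε)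
    (hc : c ∈ D) (hq : IsDeep D ε q) : Measurable (soip D c so ε) := by
  classical
  have hiter : ∀ n : ℕ, Measurable fun y => (soipStep D so ε)^[n] (soipStart D c y) := fun n =>
    ((measurable_soipStep D hso.1 ε).iterate n).comp (measurable_soipStart D c)
  have hexists : ∀ y, ∃ n, (soipStep D so ε)^[n] (soipStart D c y) ∈ D := fun y =>
    exists_soipStep_iterate_mem hso hε hc hq (soipStart_sub_mem D c y)
  have hindex : Measurable fun y =>
      sInf {n : ℕ | (soipStep D so ε)^[n] (soipStart D c y) ∈ D} := by
    simp only [fun y => Nat.sInf_def (s := {_n | _ ∈ D}) (hexists y)]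
    exact measurable_find hexists fun _ => hiter _ hD
  exact (measurable_from_prod_countable_left hiter :
    Measurable fun p : Vec d × ℕ => (soipStep D so ε)^[p.2] (soipStart D c p.1)).comp
      (measurable_id.prodMk hindex)

end InfeasibleProjection

section Shrinking

variable {d : ℕ} {K : Set (Vec d)} {c x w v : Vec d} {r δ r' δ' ε : ℝ}

theorem one_sub_div_pos (hr : 0 < r) (hδ : δ < r) : 0 < 1 - δ / r :=
  sub_pos.2 ((div_lt_one hr).2 hδ)

theorem shrink_sub_shrink (c : Vec d) (r δ : ℝ) (x y : Vec d) :
    shrink c r δ x - shrink c r δ y = (1 - δ / r) • (x - y) := by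
  unfold shrink
  module

theorem shrink_comm (c : Vec d) (r δ r' δ' : ℝ) (x : Vec d) :
    shrink c r δ (shrink c r' δ' x) = shrink c r' δ' (shrink c r δ x) := by
  unfold shrink
  module

theorem sub_shrink (c : Vec d) (r δ : ℝ) (x : Vec d) :
    x - shrink c r δ x = (δ / r) • (x - c) := by
  unfold shrink
  module

theorem shrink_add_smul (hr : r ≠ 0) (c : Vec d) (δ : ℝ) (x u : Vec d) :
    shrink c r δ x + δ • u = (1 - δ / r) • x + (1 - (1 - δ / r)) • (c + r • u) := by
  have hδ : (δ / r) • r • u = δ • u := by rw [smul_smul, div_mul_cancel₀ _ hr]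
  rw [sub_sub_cancel, smul_add, hδ, shrink]
  module

@[fun_prop]
theorem continuous_shrink {α : Type*} [TopologicalSpace α] (c : Vec d) (r δ : ℝ) {x : α → Vec d}
    (hx : Continuous x) : Continuous fun a => shrink c r δ (x a) := by
  unfold shrink
  fun_prop

@[fun_prop]
theorem continuous_unshrink {α : Type*} [TopologicalSpace α] (c : Vec d) (r δ : ℝ)
    {x : α → Vec d} (hx : Continuous x) : Continuous fun a => unshrink c r δ (x a) := by
  unfold unshrink
  fun_prop

theorem unshrink_shrink (hr : 0 < r) (hδ : δ < r) (c x : Vec d) :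
    unshrink c r δ (shrink c r δ x) = x := by
  simp [unshrink, shrink, smul_smul, inv_mul_cancel₀ (one_sub_div_pos hr hδ).ne']

theorem shrink_unshrink (hr : 0 < r) (hδ : δ < r) (c x : Vec d) :
    shrink c r δ (unshrink c r δ x) = x := by
  simp [unshrink, shrink, smul_smul, mul_inv_cancel₀ (one_sub_div_pos hr hδ).ne']

theorem convex_shrunkSet (hK : Convex ℝ K) (c : Vec d) (r δ : ℝ) : Convex ℝ (shrunkSet K c r δ) :=
  hK.affine_image (AffineMap.homothety c (1 - δ / r))

theorem vectorSpan_shrunkSet_le (K : Set (Vec d)) (c : Vec d) (r δ : ℝ) :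
    vectorSpan ℝ (shrunkSet K c r δ) ≤ vectorSpan ℝ K := by
  refine Submodule.span_le.2 ?_
  rintro _ ⟨_, ⟨x, hx, rfl⟩, _, ⟨y, hy, rfl⟩, rfl⟩
  simp only [vsub_eq_sub, shrink_sub_shrink]
  exact Submodule.smul_mem _ _ (sub_mem_vectorSpan hx hy)

namespace IsDeep

theorem shrink (h : IsDeep K r c) (hK : Convex ℝ K) (hδ : 0 < δ) (hδr : δ ≤ r) (hx : x ∈ K) :
    IsDeep K δ (shrink c r δ x) := by
  have hr : 0 < r := hδ.trans_le hδr
  have hball : ∀ u ∈ vectorSpan ℝ K, ‖u‖ ≤ 1 → DRSub.shrink c r δ x + δ • u ∈ K := by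
    intro u hu hu1
    rw [shrink_add_smul hr.ne']
    refine hK hx (h.2 _ (Submodule.smul_mem _ r hu) ?_)
      (sub_nonneg.2 ((div_le_one hr).2 hδr)) (by rw [sub_sub_cancel]; positivity) (by ring)
    rw [norm_smul, Real.norm_of_nonneg hr.le]
    exact mul_le_of_le_one_right hr.le hu1
  refine ⟨by simpa using hball 0 (Submodule.zero_mem _) (by simp), fun w hw hwδ => ?_⟩
  rw [← smul_inv_smul₀ hδ.ne' w]
  refine hball _ (Submodule.smul_mem _ _ hw) ?_
  rwa [norm_smul, norm_inv, Real.norm_of_nonneg hδ.le, inv_mul_le_one₀ hδ]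

theorem shrunkSet (h : IsDeep K r c) (hr : 0 < r) (hδ : δ < r) :
    IsDeep (shrunkSet K c r δ) (r - δ) c := by
  have hpos := one_sub_div_pos hr hδ
  refine ⟨⟨c, h.1, by simp [DRSub.shrink]⟩, fun w hw hwr => ⟨c + (1 - δ / r)⁻¹ • w,
    h.2 _ (Submodule.smul_mem _ _ (vectorSpan_shrunkSet_le K c r δ hw)) ?_, ?_⟩⟩
  · rw [norm_smul, norm_inv, Real.norm_of_nonneg hpos.le, inv_mul_le_iff₀ hpos]
    exact hwr.trans_eq (by field_simp)
  · rw [DRSub.shrink, add_sub_cancel_left, smul_inv_smul₀ hpos.ne', add_comm]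

theorem eventually_add_smul_mem (h : IsDeep K ε x) (hw : w ∈ vectorSpan ℝ K) (hwε : ‖w‖ < ε)
    (hv : v ∈ vectorSpan ℝ K) : ∀ᶠ t : ℝ in nhds 0, x + w + t • v ∈ K := by
  have hcont : Filter.Tendsto (fun t : ℝ => ‖w + t • v‖) (nhds 0) (nhds ‖w‖) :=
    (by fun_prop : Continuous fun t : ℝ => ‖w + t • v‖).tendsto' _ _ (by simp)
  filter_upwards [hcont.eventually_lt_const hwε] with t ht
  rw [add_assoc]
  exact h.2 _ (Submodule.add_mem _ hw (Submodule.smul_mem _ t hv)) ht.le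

end IsDeep

theorem isDeep_of_closedBall_inter_affineSpan_subset (hc : c ∈ K)
    (h : Metric.closedBall c r ∩ (affineSpan ℝ K : Set (Vec d)) ⊆ K) : IsDeep K r c := by
  refine ⟨hc, fun w hw hwr => h ⟨by simpa using hwr, ?_⟩⟩
  have hmem := AffineSubspace.vadd_mem_of_mem_direction (s := affineSpan ℝ K) (v := w)
    (by rwa [direction_affineSpan]) (mem_affineSpan ℝ hc)
  rwa [vadd_eq_add, add_comm] at hmem

end Shrinking

section DownClosed

variable {d : ℕ} {K : Set (Vec d)} {x y w : Vec d} {z : ℝ}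

theorem norm_sub_le_sqrt (hx : x ∈ unitCube d) (hy : y ∈ unitCube d) : ‖x - y‖ ≤ √d := by
  rw [EuclideanSpace.norm_eq]
  refine Real.sqrt_le_sqrt ?_
  calc ∑ i, ‖(x - y) i‖ ^ 2 ≤ ∑ _i : Fin d, (1 : ℝ) := by
        refine Finset.sum_le_sum fun i _ => ?_
        rw [Real.norm_eq_abs, sq_abs, PiLp.sub_apply, sq_le_one_iff_abs_le_one, abs_le]
        constructor <;> linarith [(hx i).1, (hx i).2, (hy i).1, (hy i).2]
    _ = d := by simp

theorem isBounded_unitCube (d : ℕ) : Bornology.IsBounded (unitCube d) :=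
  Metric.isBounded_iff.2 ⟨√d, fun x hx y hy => (dist_eq_norm x y).trans_le (norm_sub_le_sqrt hx hy)⟩

namespace IsDownClosed

theorem hMap_mem (hK : IsDownClosed K) (hcube : K ⊆ unitCube d) (hx : x ∈ K)
    (hz : z ∈ Set.Icc (0 : ℝ) 1) : hMap z x ∈ K :=
  hK x hx _ fun i => ⟨(hMap_mem_unitCube hz.1 (hcube hx) i).1, hMap_apply_le hz.2 (hcube hx i).1⟩

theorem mem_vectorSpan (hK : IsDownClosed K) (hcube : K ⊆ unitCube d) (hx : x ∈ K) :
    x ∈ vectorSpan ℝ K := by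
  have hzero : (0 : Vec d) ∈ K := hK x hx 0 fun i => ⟨le_rfl, (hcube hx i).1⟩
  simpa using sub_mem_vectorSpan hx hzero

theorem single_apply_mem (hK : IsDownClosed K) (hcube : K ⊆ unitCube d) (hx : x ∈ K)
    (i : Fin d) : PiLp.single 2 i (x i) ∈ K := by
  refine hK x hx _ fun j => ?_
  rw [PiLp.single_apply]
  split_ifs with hji
  · subst hji
    exact ⟨(hcube hx _).1, le_rfl⟩
  · exact ⟨le_rfl, (hcube hx j).1⟩

theorem single_mem_vectorSpan (hK : IsDownClosed K) (hcube : K ⊆ unitCube d)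
    (hw : w ∈ vectorSpan ℝ K) {i : Fin d} (hi : w i ≠ 0) (a : ℝ) :
    PiLp.single 2 i a ∈ vectorSpan ℝ K := by
  obtain ⟨x, hx, hxi⟩ : ∃ x ∈ K, x i ≠ 0 := by
    by_contra! hzero
    have hker : vectorSpan ℝ K ≤
        LinearMap.ker (EuclideanSpace.proj i : Vec d →L[ℝ] ℝ).toLinearMap := by
      refine Submodule.span_le.2 ?_
      rintro _ ⟨x, hx, y, hy, rfl⟩
      simp [hzero x hx, hzero y hy]
    exact hi (by simpa using hker hw)
  have hsingle := Submodule.smul_mem _ (a / x i)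
    (hK.mem_vectorSpan hcube (hK.single_apply_mem hcube hx i))
  rwa [← PiLp.toLp_single, ← WithLp.toLp_smul, ← Pi.single_smul, smul_eq_mul,
    div_mul_cancel₀ _ hxi] at hsingle

/-- As `K` is down-closed, its direction is spanned by coordinate vectors. -/
theorem expScale_mem_vectorSpan (hK : IsDownClosed K) (hcube : K ⊆ unitCube d) (z : ℝ)
    (x : Vec d) (hw : w ∈ vectorSpan ℝ K) : expScale z x w ∈ vectorSpan ℝ K := by
  have hsum : expScale z x w = ∑ i, PiLp.single 2 i (expScale z x w i) := by
    ext j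
    simp
  rw [hsum]
  refine Submodule.sum_mem _ fun i _ => ?_
  by_cases hi : w i = 0
  · rw [expScale_apply, hi, zero_mul, (PiLp.single_eq_zero_iff _ _).2 rfl]
    exact Submodule.zero_mem _
  · exact hK.single_mem_vectorSpan hcube hw hi _

end IsDownClosed

end DownClosed

section Input

variable {d : ℕ}

/-- The assumptions on the input of the algorithm under which it is well defined. -/
structure Input.Valid (p : Input d) : Prop where
  r_pos : 0 < p.r
  v_pos : 0 < p.v
  B₀_pos : 0 < p.B₀
  sub_cube : p.K ⊆ unitCube d
  closed : IsClosed p.K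
  convex : Convex ℝ p.K
  down : IsDownClosed p.K
  nontrivial : p.K.Nontrivial
  c_mem : p.c ∈ p.K
  ball_sub : Metric.closedBall p.c p.r ∩ (affineSpan ℝ p.K : Set (Vec d)) ⊆ p.K
  T_pos : 1 ≤ p.T
  δ_lt : p.δ < p.r
  ε_lt : p.ε < p.rDom
  oracle : IsSeparationOracle p.dom p.so

/-- The point of the shrunk domain with which the iterates of SO-OGA are compared when `y ∈ K` is
the comparator: the infeasible projection only decreases distances to points which are `ε`-deep in
the shrunk domain. -/
def Input.comparator (p : Input d) (y : Vec d) : Vec d :=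
  shrink p.c p.r p.δ (shrink p.c p.rDom p.ε y)

namespace Input.Valid

variable {p : Input d} {x y u : Vec d} (hp : p.Valid)
include hp

theorem δ_pos : 0 < p.δ := Real.rpow_pos_of_pos (Nat.cast_pos.2 hp.T_pos) _

theorem ε_pos : 0 < p.ε :=
  mul_pos hp.v_pos (Real.rpow_pos_of_pos (Nat.cast_pos.2 hp.T_pos) _)

theorem rDom_pos : 0 < p.rDom := sub_pos.2 hp.δ_lt

theorem ratio_pos : 0 < 1 - p.δ / p.r := one_sub_div_pos hp.r_pos hp.δ_lt

theorem isCompact : IsCompact p.K :=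
  Metric.isCompact_of_isClosed_isBounded hp.closed ((isBounded_unitCube d).subset hp.sub_cube)

theorem isDeep_center : IsDeep p.K p.r p.c :=
  isDeep_of_closedBall_inter_affineSpan_subset hp.c_mem hp.ball_sub

theorem isDeep_shrink (hx : x ∈ p.K) : IsDeep p.K p.δ (shrink p.c p.r p.δ x) :=
  hp.isDeep_center.shrink hp.convex hp.δ_pos hp.δ_lt.le hx

theorem isDeep_dom_center : IsDeep p.dom p.rDom p.c :=
  hp.isDeep_center.shrunkSet hp.r_pos hp.δ_lt

theorem isDeep_comparator (hy : y ∈ p.K) : IsDeep p.dom p.ε (p.comparator y) := by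
  rw [Input.comparator, shrink_comm]
  exact hp.isDeep_dom_center.shrink (convex_shrunkSet hp.convex _ _ _) hp.ε_pos hp.ε_lt.le
    (Set.mem_image_of_mem _ hy)

theorem shrink_rDom_ε_mem (hy : y ∈ p.K) : shrink p.c p.rDom p.ε y ∈ p.K := by
  obtain ⟨x, hx, hxy⟩ := (hp.isDeep_comparator hy).1
  rwa [← unshrink_shrink hp.r_pos hp.δ_lt p.c (shrink p.c p.rDom p.ε y),
    show shrink p.c p.r p.δ _ = shrink p.c p.r p.δ x from hxy.symm,
    unshrink_shrink hp.r_pos hp.δ_lt]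

theorem shrink_add_smul_mem (hx : x ∈ p.K) (hu : u ∈ p.L₀) (hu1 : ‖u‖ ≤ 1) :
    shrink p.c p.r p.δ x + p.δ • u ∈ p.K := by
  refine (hp.isDeep_shrink hx).2 _ (Submodule.smul_mem _ _ hu) ?_
  rw [norm_smul, Real.norm_of_nonneg hp.δ_pos.le]
  exact mul_le_of_le_one_right hp.δ_pos.le hu1

theorem expScale_mem_L₀ (z : ℝ) (x : Vec d) (hu : u ∈ p.L₀) : expScale z x u ∈ p.L₀ :=
  hp.down.expScale_mem_vectorSpan hp.sub_cube z x hu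

theorem hMap_mem (hx : x ∈ p.K) {z : ℝ} (hz : z ∈ Set.Icc (0 : ℝ) 1) : hMap z x ∈ p.K :=
  hp.down.hMap_mem hp.sub_cube hx hz

theorem nontrivial_L₀ : Nontrivial p.L₀ := by
  obtain ⟨x, hx, y, hy, hxy⟩ := hp.nontrivial
  exact ⟨⟨x, hp.down.mem_vectorSpan hp.sub_cube hx⟩, ⟨y, hp.down.mem_vectorSpan hp.sub_cube hy⟩,
    fun h => hxy (congrArg Subtype.val h)⟩

theorem unshrink_mem (hx : x ∈ p.dom) : unshrink p.c p.r p.δ x ∈ p.K := by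
  obtain ⟨y, hy, rfl⟩ := hx
  rwa [unshrink_shrink hp.r_pos hp.δ_lt]

theorem dom_subset : p.dom ⊆ p.K := by
  rintro _ ⟨y, hy, rfl⟩
  exact (hp.isDeep_shrink hy).1

theorem isCompact_dom : IsCompact p.dom :=
  hp.isCompact.image (by fun_prop)

theorem nontrivial_dom : p.dom.Nontrivial :=
  hp.nontrivial.image_of_injOn
    (Function.LeftInverse.injective (unshrink_shrink hp.r_pos hp.δ_lt p.c)).injOn

theorem soip_mem_dom (y : Vec d) : soip p.dom p.c p.so p.ε y ∈ p.dom :=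
  soip_mem hp.oracle hp.ε_pos hp.isDeep_dom_center.1 (hp.isDeep_comparator hp.c_mem) y

theorem measurable_soip_dom : Measurable (soip p.dom p.c p.so p.ε) :=
  measurable_soip hp.isCompact_dom.isClosed.measurableSet hp.oracle hp.ε_pos
    hp.isDeep_dom_center.1 (hp.isDeep_comparator hp.c_mem)

theorem norm_soip_dom_sub_comparator_le (hy : y ∈ p.K) (x : Vec d) :
    ‖soip p.dom p.c p.so p.ε x - p.comparator y‖ ≤ ‖x - p.comparator y‖ :=
  norm_soip_sub_le hp.isCompact_dom.isBounded hp.nontrivial_dom hp.oracle hp.ε_pos.le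
    hp.isDeep_dom_center.1 (hp.isDeep_comparator hy) x

variable (z : ℕ → ℝ) (u : ℕ → Vec d) (o : ℕ → ℝ)

theorem iter_mem (t : ℕ) : p.iter z u o t ∈ p.dom := by
  cases t with
  | zero => exact hp.isDeep_dom_center.1
  | succ t => exact hp.soip_mem_dom _

theorem action_mem (t : ℕ) : p.action z u o t ∈ p.K :=
  (hp.isDeep_shrink (hp.hMap_mem (hp.unshrink_mem (hp.iter_mem z u o t))
    ⟨zero_le_one, le_rfl⟩)).1

variable {z u}

theorem query_mem {t : ℕ} (hz : z t ∈ Set.Icc (0 : ℝ) 1) (hu : u t ∈ p.L₀) (hu1 : ‖u t‖ ≤ 1) :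
    p.query z u o t ∈ p.K :=
  hp.shrink_add_smul_mem (hp.hMap_mem (hp.unshrink_mem (hp.iter_mem z u o t)) hz) hu hu1

end Input.Valid

end Input

section SamplingLaws

theorem one_sub_exp_neg_one_pos : 0 < 1 - Real.exp (-1) :=
  sub_pos.2 (Real.exp_lt_one_iff.2 (by norm_num))

theorem integral_bqndLaw (φ : ℝ → ℝ) : ∫ z, φ z ∂bqndLaw =
    (1 - Real.exp (-1))⁻¹ * ∫ z in Set.Icc (0 : ℝ) 1, Real.exp (z - 1) * φ z := by
  have hpos := one_sub_exp_neg_one_pos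
  rw [bqndLaw, integral_withDensity_eq_integral_toReal_smul (by fun_prop)
    (.of_forall fun _ => ENNReal.ofReal_lt_top), ← integral_const_mul]
  refine integral_congr_ae (.of_forall fun z => ?_)
  simp only [smul_eq_mul]
  rw [ENNReal.toReal_ofReal (by positivity)]
  ring

instance : IsProbabilityMeasure bqndLaw := by
  have hpos := one_sub_exp_neg_one_pos
  have hint : IntegrableOn (fun z : ℝ => Real.exp (z - 1) / (1 - Real.exp (-1)))
      (Set.Icc 0 1) := Continuous.integrableOn_Icc (by fun_prop)
  constructor
  rw [bqndLaw, withDensity_apply _ MeasurableSet.univ, Measure.restrict_univ,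
    ← ofReal_integral_eq_lintegral_ofReal hint (.of_forall fun z => by positivity),
    integral_Icc_eq_integral_Ioc, ← intervalIntegral.integral_of_le zero_le_one,
    intervalIntegral.integral_div, intervalIntegral.integral_comp_sub_right (fun z => Real.exp z),
    integral_exp]
  simp [div_self hpos.ne']

theorem ae_bqndLaw : ∀ᵐ z ∂bqndLaw, z ∈ Set.Icc (0 : ℝ) 1 :=
  (withDensity_absolutelyContinuous _ _).ae_le (ae_restrict_mem measurableSet_Icc)

variable {d : ℕ} (L : Submodule ℝ (Vec d))

theorem measurableEmbedding_sphere :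
    MeasurableEmbedding fun u : Metric.sphere (0 : L) 1 => ((u : L) : Vec d) :=
  (MeasurableEmbedding.subtype_coe L.closed_of_finiteDimensional.measurableSet).comp
    (MeasurableEmbedding.subtype_coe Metric.isClosed_sphere.measurableSet)

theorem integral_uniformSphere (φ : Vec d → ℝ) : ∫ u, φ u ∂(uniformSphere L) =
    (Module.finrank ℝ L * (volume : Measure L).real (Metric.ball 0 1))⁻¹ *
      ∫ u : Metric.sphere (0 : L) 1, φ ((u : L) : Vec d) ∂(volume : Measure L).toSphere := by
  rw [uniformSphere, integral_smul_measure, (measurableEmbedding_sphere L).integral_map,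
    ENNReal.toReal_inv, ← Measure.toSphere_real_apply_univ]
  rfl

instance [Nontrivial L] : IsProbabilityMeasure (uniformSphere L) := by
  constructor
  rw [uniformSphere, Measure.smul_apply,
    Measure.map_apply (measurableEmbedding_sphere L).measurable MeasurableSet.univ,
    Set.preimage_univ, smul_eq_mul]
  refine ENNReal.inv_mul_cancel ?_ (measure_ne_top _ _)
  rw [Ne, Measure.measure_univ_eq_zero]
  exact Measure.toSphere_ne_zero _

theorem ae_uniformSphere : ∀ᵐ u ∂(uniformSphere L), u ∈ L ∧ ‖u‖ = 1 := by
  refine Measure.ae_smul_measure ?_ _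
  rw [(measurableEmbedding_sphere L).ae_map_iff]
  exact .of_forall fun u => ⟨(u : L).2, mem_sphere_zero_iff_norm.1 u.2⟩

theorem ae_bqndLaw_prod_uniformSphere [Nontrivial L] :
    ∀ᵐ q ∂(bqndLaw.prod (uniformSphere L)), q.1 ∈ Set.Icc (0 : ℝ) 1 ∧ q.2 ∈ L ∧ ‖q.2‖ = 1 :=
  (Measure.quasiMeasurePreserving_fst.ae ae_bqndLaw).and
    (Measure.quasiMeasurePreserving_snd.ae (ae_uniformSphere L))

end SamplingLaws

section Lipschitz

variable {d : ℕ} {K : Set (Vec d)} {M₁ : ℝ} {f : Vec d → ℝ}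

theorem IsDRSubmodular.nonneg_bound (hf : IsDRSubmodular K M₁ f) (hK : K.Nonempty) : 0 ≤ M₁ := by
  obtain ⟨-, g, -, -, hg⟩ := hf
  obtain ⟨x, hx⟩ := hK
  exact (norm_nonneg _).trans (hg x hx)

theorem IsDRSubmodular.abs_sub_le (hf : IsDRSubmodular K M₁ f) (hcube : K ⊆ unitCube d)
    (hK : Convex ℝ K) {x y : Vec d} (hx : x ∈ K) (hy : y ∈ K) : |f x - f y| ≤ M₁ * ‖x - y‖ := by
  obtain ⟨-, g, hgrad, -, hg⟩ := hf
  exact hK.norm_image_sub_le_of_norm_hasFDerivWithin_le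
    (fun x hx => (hgrad x (hcube hx)).hasFDerivWithinAt.mono hcube)
    (fun x hx => by rw [LinearIsometryEquiv.norm_map]; exact hg x hx) hy hx

theorem IsDRSubmodular.exists_lipschitzWith_eqOn (hf : IsDRSubmodular K M₁ f)
    (hcube : K ⊆ unitCube d) (hK : Convex ℝ K) (hne : K.Nonempty) :
    ∃ F : Vec d → ℝ, LipschitzWith M₁.toNNReal F ∧ Set.EqOn f F K := by
  refine LipschitzOnWith.extend_real (LipschitzOnWith.of_dist_le_mul fun x hx y hy => ?_)
  rw [Real.dist_eq, dist_eq_norm, Real.coe_toNNReal _ (hf.nonneg_bound hne)]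
  exact hf.abs_sub_le hcube hK hx hy

end Lipschitz

section Smoothing

open scoped NNReal

variable {d : ℕ}

/-- The one-point estimate of a directional derivative is unbiased for the smoothed function. -/
theorem setAverage_ball_lineDeriv (L : Submodule ℝ (Vec d)) [Nontrivial L] {C : ℝ≥0}
    {F : Vec d → ℝ} (hF : LipschitzWith C F) {δ : ℝ} (hδ : 0 < δ) (b : Vec d) {v : Vec d}
    (hv : v ∈ L) :
    ⨍ x in Metric.ball (0 : L) 1, lineDeriv ℝ F (b + δ • (x : Vec d)) v =
      Module.finrank ℝ L / δ * ∫ u, F (b + δ • u) * inner ℝ u v ∂uniformSphere L := by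
  have hlip : LipschitzWith (C * δ.toNNReal) fun x : L => F (b + δ • (x : Vec d)) := by
    refine hF.comp (LipschitzWith.of_dist_le_mul fun x y => ?_)
    rw [dist_add_left, dist_smul₀, Real.norm_of_nonneg hδ.le, Real.coe_toNNReal _ hδ.le]
    exact le_rfl
  have hchain : ∀ x : L, lineDeriv ℝ (fun x : L => F (b + δ • (x : Vec d))) x ⟨v, hv⟩ =
      δ * lineDeriv ℝ F (b + δ • (x : Vec d)) v := by
    intro x
    rw [← smul_eq_mul, ← lineDeriv_smul]
    simp only [lineDeriv, Submodule.coe_add, Submodule.coe_smul, smul_add, add_assoc,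
      smul_comm δ]
  have hsphere := setIntegral_ball_lineDeriv (volume : Measure L) hlip ⟨v, hv⟩ zero_lt_one
  simp only [hchain, integral_const_mul, one_pow, one_mul, one_smul] at hsphere
  have hk : (Module.finrank ℝ L : ℝ) ≠ 0 := Nat.cast_ne_zero.2 Module.finrank_pos.ne'
  rw [setAverage_eq, smul_eq_mul, integral_uniformSphere, mul_inv]
  field_simp
  rw [mul_comm _ δ, hsphere]
  simp only [mul_comm (F _)]
  rfl

theorem lineDeriv_eq_inner_of_eqOn {E : Type*} [NormedAddCommGroup E] [InnerProductSpace ℝ E]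
    [CompleteSpace E] {f F : E → ℝ} {g x v : E} {S S' : Set E}
    (hf : HasGradientWithinAt f g S' x) (hS : S ⊆ S') (hEq : Set.EqOn f F S) (hx : x ∈ S)
    (hnear : ∀ᶠ t : ℝ in nhds 0, x + t • v ∈ S) : lineDeriv ℝ F x v = inner ℝ g v := by
  have hF := (hf.hasFDerivWithinAt.mono hS).congr (fun y hy => (hEq hy).symm) (hEq hx).symm
  simpa using ((hF.hasLineDerivWithinAt v).hasLineDerivAt' hnear).lineDeriv

end Smoothing

section Linearization

open scoped NNReal

variable {d : ℕ} {p : Input d} {F f : Vec d → ℝ} {C : ℝ≥0} {w ξ y : Vec d}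

/-- The inner product of `w` with the estimate `expScale z ξ ((k / δ) o u)` of the linearized
gradient at `shrink ξ`, for the samples `q = (z, u)` and the answer `o = F (query point)`. -/
def innerEstimate (p : Input d) (F : Vec d → ℝ) (w ξ : Vec d) (q : ℝ × Vec d) : ℝ :=
  p.k / p.δ * F (shrink p.c p.r p.δ (hMap q.1 ξ) + p.δ • q.2) * inner ℝ (expScale q.1 ξ q.2) w

/-- The line derivative of `F` at a perturbed query point, in the direction `expScale z ξ w`. -/
def queryDeriv (p : Input d) (F : Vec d → ℝ) (w ξ : Vec d) (z : ℝ) (x : p.L₀) : ℝ :=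
  lineDeriv ℝ F (shrink p.c p.r p.δ (hMap z ξ) + p.δ • (x : Vec d)) (expScale z ξ w)

theorem continuous_innerEstimate (p : Input d) (hF : Continuous F) :
    Continuous fun m : Vec d × Vec d × ℝ × Vec d => innerEstimate p F m.1 m.2.1 m.2.2 := by
  unfold innerEstimate
  fun_prop

theorem Input.Valid.exists_norm_innerEstimate_le (hp : p.Valid) (hF : Continuous F)
    {S : Set (Vec d)} (hS : IsCompact S) : ∃ B, ∀ w ∈ S, ∀ ξ ∈ p.K, ∀ q : ℝ × Vec d,
      q.1 ∈ Set.Icc (0 : ℝ) 1 → ‖q.2‖ = 1 → ‖innerEstimate p F w ξ q‖ ≤ B := by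
  obtain ⟨B, hB⟩ := (hS.prod (hp.isCompact.prod ((isCompact_Icc (a := (0 : ℝ)) (b := 1)).prod
    (isCompact_sphere (0 : Vec d) 1)))).exists_bound_of_continuousOn
    (continuous_innerEstimate p hF).continuousOn
  exact ⟨B, fun w hw ξ hξ q hz hu => hB (w, ξ, q) ⟨hw, hξ, hz, by simpa using hu⟩⟩

theorem Input.Valid.integrable_innerEstimate (hp : p.Valid) (hF : Continuous F) (w : Vec d)
    (hξ : ξ ∈ p.K) : Integrable (innerEstimate p F w ξ) (bqndLaw.prod (uniformSphere p.L₀)) := by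
  have := hp.nontrivial_L₀
  obtain ⟨B, hB⟩ := hp.exists_norm_innerEstimate_le hF (isCompact_singleton (x := w))
  refine Integrable.of_bound (C := B) ?_ ?_
  · exact ((continuous_innerEstimate p hF).comp (by fun_prop :
      Continuous fun q : ℝ × Vec d => (w, ξ, q))).aestronglyMeasurable
  · filter_upwards [ae_bqndLaw_prod_uniformSphere p.L₀] with q hq
    exact hB w rfl ξ hξ q hq.1 hq.2.2

theorem measurable_exp_mul_queryDeriv (p : Input d) (hF : Continuous F) (w ξ : Vec d) :
    Measurable fun m : p.L₀ × ℝ => Real.exp (m.2 - 1) * queryDeriv p F w ξ m.2 m.1 :=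
  Measurable.mul (by fun_prop) ((measurable_lineDeriv_uncurry hF).comp (by fun_prop :
    Continuous fun m : p.L₀ × ℝ => (shrink p.c p.r p.δ (hMap m.2 ξ) + p.δ • (m.1 : Vec d),
      expScale m.2 ξ w)).measurable)

theorem norm_exp_mul_queryDeriv_le (hF : LipschitzWith C F) (w : Vec d) (hξ : ξ ∈ unitCube d)
    {z : ℝ} (hz : z ∈ Set.Icc (0 : ℝ) 1) (x : p.L₀) :
    ‖Real.exp (z - 1) * queryDeriv p F w ξ z x‖ ≤ C * ‖w‖ := by
  rw [norm_mul, Real.norm_of_nonneg (Real.exp_pos _).le]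
  calc Real.exp (z - 1) * ‖queryDeriv p F w ξ z x‖
      ≤ ‖queryDeriv p F w ξ z x‖ :=
        mul_le_of_le_one_left (norm_nonneg _) (Real.exp_le_one_iff.2 (sub_nonpos.2 hz.2))
    _ ≤ C * ‖expScale z ξ w‖ := norm_lineDeriv_le_of_lipschitz ℝ hF
    _ ≤ C * ‖w‖ := mul_le_mul_of_nonneg_left (norm_expScale_le hz.1 hξ w) C.2

theorem Input.Valid.setAverage_queryDeriv (hp : p.Valid) (hF : LipschitzWith C F)
    (hw : w ∈ p.L₀) (ξ : Vec d) (z : ℝ) :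
    ⨍ x in Metric.ball (0 : p.L₀) 1, queryDeriv p F w ξ z x =
      ∫ u, innerEstimate p F w ξ (z, u) ∂uniformSphere p.L₀ := by
  have := hp.nontrivial_L₀
  simp only [queryDeriv, innerEstimate, inner_expScale_left, mul_assoc, integral_const_mul]
  exact setAverage_ball_lineDeriv p.L₀ hF hp.δ_pos _ (hp.expScale_mem_L₀ z ξ hw)

theorem Input.Valid.integrable_exp_mul_queryDeriv (hp : p.Valid) (hF : LipschitzWith C F)
    (w : Vec d) (hξ : ξ ∈ p.K) : Integrable
      (Function.uncurry fun (x : p.L₀) z => Real.exp (z - 1) * queryDeriv p F w ξ z x)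
      ((volume.restrict (Metric.ball (0 : p.L₀) 1)).prod
        (volume.restrict (Set.Icc (0 : ℝ) 1))) := by
  have : IsFiniteMeasure (volume.restrict (Metric.ball (0 : p.L₀) 1)) :=
    isFiniteMeasure_restrict.2 measure_ball_lt_top.ne
  refine Integrable.of_bound (C := C * ‖w‖)
    (measurable_exp_mul_queryDeriv p hF.continuous w ξ).aestronglyMeasurable ?_
  filter_upwards [Measure.quasiMeasurePreserving_snd.ae (ae_restrict_mem measurableSet_Icc)]
    with m hm
  exact norm_exp_mul_queryDeriv_le hF w (hp.sub_cube hξ) hm m.1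

theorem Input.Valid.integral_innerEstimate (hp : p.Valid) (hF : LipschitzWith C F)
    (hw : w ∈ p.L₀) (hξ : ξ ∈ p.K) :
    (1 - Real.exp (-1)) * ∫ q, innerEstimate p F w ξ q ∂bqndLaw.prod (uniformSphere p.L₀) =
      ⨍ x in Metric.ball (0 : p.L₀) 1, ∫ z in Set.Icc (0 : ℝ) 1,
        Real.exp (z - 1) * queryDeriv p F w ξ z x := by
  have := hp.nontrivial_L₀
  rw [integral_prod _ (hp.integrable_innerEstimate hF.continuous w hξ), integral_bqndLaw,
    mul_inv_cancel_left₀ one_sub_exp_neg_one_pos.ne']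
  simp only [← hp.setAverage_queryDeriv hF hw, setAverage_eq, smul_eq_mul]
  rw [integral_integral_swap (hp.integrable_exp_mul_queryDeriv hF w hξ), ← integral_const_mul]
  simp only [integral_const_mul, mul_left_comm]

theorem Input.Valid.queryDeriv_eq_inner (hp : p.Valid) {g : Vec d → Vec d}
    (hf : HasDRGradient f g) (hEq : Set.EqOn f F p.K) (hw : w ∈ p.L₀) (hξ : ξ ∈ p.K) {z : ℝ}
    (hz : z ∈ Set.Icc (0 : ℝ) 1) {x : p.L₀} (hx : ‖x‖ < 1) :
    queryDeriv p F w ξ z x =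
      inner ℝ (g (shrink p.c p.r p.δ (hMap z ξ) + p.δ • (x : Vec d))) (expScale z ξ w) := by
  have hquery := hp.shrink_add_smul_mem (hp.hMap_mem hξ hz) x.2 hx.le
  refine lineDeriv_eq_inner_of_eqOn (hf.grad _ (hp.sub_cube hquery)) hp.sub_cube hEq hquery
    ((hp.isDeep_shrink (hp.hMap_mem hξ hz)).eventually_add_smul_mem
      (Submodule.smul_mem _ _ x.2) ?_ (hp.expScale_mem_L₀ z ξ hw))
  rw [norm_smul, Real.norm_of_nonneg hp.δ_pos.le]
  exact mul_lt_of_lt_one_right hp.δ_pos hx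

/-- For a fixed perturbation `x`, this is the linearization inequality of BQND for the
DR-submodular function `ξ ↦ f (shrink ξ + δ x)`. -/
theorem Input.Valid.exp_neg_one_mul_sub_le_integral_queryDeriv (hp : p.Valid) {g : Vec d → Vec d}
    (hf : HasDRGradient f g) (hF : LipschitzWith C F) (hEq : Set.EqOn f F p.K) (hy : y ∈ p.K)
    (hξ : ξ ∈ p.K) {x : p.L₀} (hx : ‖x‖ < 1) :
    Real.exp (-1) * f (shrink p.c p.r p.δ y + p.δ • (x : Vec d)) -
        f (shrink p.c p.r p.δ (hMap 1 ξ) + p.δ • (x : Vec d)) ≤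
      ∫ z in Set.Icc (0 : ℝ) 1, Real.exp (z - 1) *
        queryDeriv p F (shrink p.c p.r p.δ y - shrink p.c p.r p.δ ξ) ξ z x := by
  set w := shrink p.c p.r p.δ y - shrink p.c p.r p.δ ξ with hw
  have hwL : w ∈ p.L₀ :=
    sub_mem_vectorSpan (hp.isDeep_shrink hy).1 (hp.isDeep_shrink hξ).1
  have hperturb : p.c + p.r • (x : Vec d) ∈ unitCube d := by
    refine hp.sub_cube (hp.isDeep_center.2 _ (Submodule.smul_mem _ _ x.2) ?_)
    rw [norm_smul, Real.norm_of_nonneg hp.r_pos.le]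
    exact mul_le_of_le_one_right hp.r_pos.le hx.le
  have hDR := hf.comp_homothety
    ⟨hp.ratio_pos.le, sub_le_self 1 (div_pos hp.δ_pos hp.r_pos).le⟩ hperturb
  simp only [← shrink_add_smul hp.r_pos.ne'] at hDR
  have hderiv : ∀ z ∈ Set.Icc (0 : ℝ) 1, Real.exp (z - 1) * inner ℝ
      ((1 - p.δ / p.r) • g (shrink p.c p.r p.δ (hMap z ξ) + p.δ • (x : Vec d)))
      (expScale z ξ (y - ξ)) = Real.exp (z - 1) * queryDeriv p F w ξ z x := fun z hz => by
    rw [hp.queryDeriv_eq_inner hf hEq hwL hξ hz hx, hw, shrink_sub_shrink, expScale_smul,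
      real_inner_smul_left, real_inner_smul_right]
  have hint : IntegrableOn (fun z => Real.exp (z - 1) * queryDeriv p F w ξ z x)
      (Set.Icc 0 1) := by
    refine Measure.integrableOn_of_bounded (M := C * ‖w‖) (by simp)
      ((measurable_exp_mul_queryDeriv p hF.continuous w ξ).comp
        measurable_prodMk_left).aestronglyMeasurable ?_
    exact (ae_restrict_iff' measurableSet_Icc).2 (.of_forall fun z hz =>
      norm_exp_mul_queryDeriv_le hF w (hp.sub_cube hξ) hz x)
  have hle := hDR.exp_neg_one_mul_sub_le (hp.sub_cube hξ) (hp.sub_cube hy)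
    (hint.congr_fun (fun z hz => (hderiv z hz).symm) measurableSet_Icc)
  rwa [intervalIntegral.integral_of_le zero_le_one, ← integral_Icc_eq_integral_Ioc,
    setIntegral_congr_fun measurableSet_Icc hderiv] at hle

/-- A bound on the loss caused by the smoothing and by moving the comparator into the shrunk
domain. -/
def shrinkLoss (p : Input d) (M₁ : ℝ) : ℝ :=
  M₁ * (√d * (p.ε / p.rDom + p.δ / p.r) + 2 * p.δ)

theorem Input.Valid.norm_sub_shrink_le (hp : p.Valid) (hy : y ∈ p.K) {r δ : ℝ}
    (hδ : 0 ≤ δ / r) : ‖y - shrink p.c r δ y‖ ≤ √d * (δ / r) := by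
  rw [sub_shrink, norm_smul, Real.norm_of_nonneg hδ, mul_comm]
  exact mul_le_mul_of_nonneg_right
    (norm_sub_le_sqrt (hp.sub_cube hy) (hp.sub_cube hp.c_mem)) hδ

theorem Input.Valid.norm_sub_comparator_add_le (hp : p.Valid) (hy : y ∈ p.K) {u : Vec d}
    (hu : ‖u‖ ≤ p.δ) :
    ‖y - (p.comparator y + u)‖ ≤ √d * (p.ε / p.rDom + p.δ / p.r) + p.δ := by
  have hε := hp.norm_sub_shrink_le hy (div_pos hp.ε_pos hp.rDom_pos).le
  have hδ := hp.norm_sub_shrink_le (hp.shrink_rDom_ε_mem hy) (div_pos hp.δ_pos hp.r_pos).le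
  set y' := shrink p.c p.rDom p.ε y
  calc ‖y - (p.comparator y + u)‖
      = ‖(y - y') + (y' - shrink p.c p.r p.δ y') - u‖ := by rw [Input.comparator]; congr 1; abel
    _ ≤ ‖y - y'‖ + ‖y' - shrink p.c p.r p.δ y'‖ + ‖u‖ :=
        (norm_sub_le _ _).trans (by gcongr; exact norm_add_le _ _)
    _ ≤ √d * (p.ε / p.rDom + p.δ / p.r) + p.δ := by linarith

theorem Input.Valid.exp_neg_one_mul_sub_sub_shrinkLoss_le (hp : p.Valid) {M₁ : ℝ}
    (hf : IsDRSubmodular p.K M₁ f) (hy : y ∈ p.K) (hξ : ξ ∈ p.K) {x : p.L₀} (hx : ‖x‖ ≤ 1) :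
    Real.exp (-1) * f y - f (shrink p.c p.r p.δ (hMap 1 ξ)) - shrinkLoss p M₁ ≤
      Real.exp (-1) * f (p.comparator y + p.δ • (x : Vec d)) -
        f (shrink p.c p.r p.δ (hMap 1 ξ) + p.δ • (x : Vec d)) := by
  have hM := hf.nonneg_bound ⟨_, hp.c_mem⟩
  have hh := hp.hMap_mem hξ ⟨zero_le_one, le_rfl⟩
  have hδx : ‖p.δ • (x : Vec d)‖ ≤ p.δ := by
    rw [norm_smul, Real.norm_of_nonneg hp.δ_pos.le]
    exact mul_le_of_le_one_right hp.δ_pos.le hx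
  set ρ := √d * (p.ε / p.rDom + p.δ / p.r) + p.δ with hρ
  have hcomp : f y - f (p.comparator y + p.δ • (x : Vec d)) ≤ M₁ * ρ :=
    (le_abs_self _).trans <| (hf.abs_sub_le hp.sub_cube hp.convex hy
      (hp.shrink_add_smul_mem (hp.shrink_rDom_ε_mem hy) x.2 hx)).trans <|
      mul_le_mul_of_nonneg_left (hp.norm_sub_comparator_add_le hy hδx) hM
  have haction : f (shrink p.c p.r p.δ (hMap 1 ξ) + p.δ • (x : Vec d)) -
      f (shrink p.c p.r p.δ (hMap 1 ξ)) ≤ M₁ * p.δ :=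
    (le_abs_self _).trans <| (hf.abs_sub_le hp.sub_cube hp.convex
      (hp.shrink_add_smul_mem hh x.2 hx) (hp.isDeep_shrink hh).1).trans <|
      mul_le_mul_of_nonneg_left (by rwa [add_sub_cancel_left]) hM
  have hρ0 : 0 ≤ M₁ * ρ :=
    mul_nonneg hM ((norm_nonneg _).trans (hp.norm_sub_comparator_add_le hy hδx))
  have hexp := (mul_le_mul_of_nonneg_left hcomp (Real.exp_pos (-1)).le).trans
    (mul_le_of_le_one_left hρ0 (sub_pos.1 one_sub_exp_neg_one_pos).le)
  have hloss : shrinkLoss p M₁ = M₁ * ρ + M₁ * p.δ := by rw [shrinkLoss, hρ]; ring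
  linarith

theorem Input.Valid.exp_neg_one_mul_sub_le_integral_innerEstimate (hp : p.Valid) {M₁ : ℝ}
    (hf : IsDRSubmodular p.K M₁ f) (hF : LipschitzWith C F) (hEq : Set.EqOn f F p.K)
    (hy : y ∈ p.K) (hξ : ξ ∈ p.K) :
    Real.exp (-1) * f y - f (shrink p.c p.r p.δ (hMap 1 ξ)) - shrinkLoss p M₁ ≤
      (1 - Real.exp (-1)) * ∫ q, innerEstimate p F (p.comparator y - shrink p.c p.r p.δ ξ) ξ q
        ∂bqndLaw.prod (uniformSphere p.L₀) := by
  have := hp.nontrivial_L₀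
  obtain ⟨hnonneg, g, hgrad, hanti, -⟩ := id hf
  set w := p.comparator y - shrink p.c p.r p.δ ξ
  have hwL : w ∈ p.L₀ := sub_mem_vectorSpan
    (hp.isDeep_shrink (hp.shrink_rDom_ε_mem hy)).1 (hp.isDeep_shrink hξ).1
  have hpointwise : ∀ x ∈ Metric.ball (0 : p.L₀) 1,
      Real.exp (-1) * f y - f (shrink p.c p.r p.δ (hMap 1 ξ)) - shrinkLoss p M₁ ≤
        ∫ z in Set.Icc (0 : ℝ) 1, Real.exp (z - 1) * queryDeriv p F w ξ z x := fun x hx => by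
    have hx1 := mem_ball_zero_iff.1 hx
    exact (hp.exp_neg_one_mul_sub_sub_shrinkLoss_le hf hy hξ hx1.le).trans
      (hp.exp_neg_one_mul_sub_le_integral_queryDeriv ⟨hnonneg, hgrad, hanti⟩ hF hEq
        (hp.shrink_rDom_ε_mem hy) hξ hx1)
  rw [hp.integral_innerEstimate hF hwL hξ]
  exact (convex_Ici _).set_average_mem isClosed_Ici (Metric.measure_ball_pos _ _ one_pos).ne'
    measure_ball_lt_top.ne
    ((ae_restrict_iff' measurableSet_ball).2 (.of_forall hpointwise))
    (hp.integrable_exp_mul_queryDeriv hF w hξ).integral_prod_left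

end Linearization

section OnlineAscent

open scoped NNReal

variable {d : ℕ} {p : Input d} {y : Vec d}

/-- The gradient estimate that BQND hands to SO-OGA in round `t`, for given samples `z`, `u` and
given answers `o` of the value oracle. -/
def Input.estimate (p : Input d) (z : ℕ → ℝ) (u : ℕ → Vec d) (o : ℕ → ℝ) (t : ℕ) : Vec d :=
  bqndOutput p.c p.r p.δ (z t) (p.iter z u o t) ((p.k / p.δ * o t) • u t)

namespace Input.Valid

variable (hp : p.Valid)
include hp

theorem k_pos : 0 < (p.k : ℝ) := by
  have := hp.nontrivial_L₀
  exact_mod_cast Module.finrank_pos (R := ℝ) (M := p.L₀)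

theorem B₁_pos : 0 < p.B₁ :=
  mul_pos (div_pos hp.k_pos hp.δ_pos) hp.B₀_pos

theorem η_pos : 0 < p.η :=
  mul_pos (div_pos (mul_pos hp.v_pos hp.rDom_pos) (mul_pos two_pos hp.B₁_pos))
    (Real.rpow_pos_of_pos (Nat.cast_pos.2 hp.T_pos) _)

theorem comparator_mem (hy : y ∈ p.K) : p.comparator y ∈ p.K :=
  hp.dom_subset (hp.isDeep_comparator hy).1

variable (z : ℕ → ℝ) (u : ℕ → Vec d) (o : ℕ → ℝ)

theorem norm_sub_iter_le (hy : y ∈ p.K) (t : ℕ) : ‖y - p.iter z u o t‖ ≤ √d :=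
  norm_sub_le_sqrt (hp.sub_cube hy) (hp.sub_cube (hp.dom_subset (hp.iter_mem z u o t)))

variable {z u o}

theorem norm_estimate_le {t : ℕ} (hz : z t ∈ Set.Icc (0 : ℝ) 1) (hu : ‖u t‖ = 1)
    (ho : |o t| ≤ p.B₀) : ‖p.estimate z u o t‖ ≤ p.B₁ := by
  have hk : 0 ≤ (p.k : ℝ) / p.δ := (div_pos hp.k_pos hp.δ_pos).le
  calc ‖p.estimate z u o t‖
      ≤ ‖(p.k / p.δ * o t) • u t‖ :=
        norm_expScale_le hz.1 (hp.sub_cube (hp.unshrink_mem (hp.iter_mem z u o t))) _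
    _ = p.k / p.δ * |o t| := by
        rw [norm_smul, hu, mul_one, norm_mul, Real.norm_of_nonneg hk, Real.norm_eq_abs]
    _ ≤ p.B₁ := mul_le_mul_of_nonneg_left ho hk

theorem two_mul_inner_comparator_sub_le (hy : y ∈ p.K) (x g : Vec d) :
    2 * p.η * inner ℝ g (p.comparator y - x) ≤ ‖p.comparator y - x‖ ^ 2 -
      ‖p.comparator y - soogaStep p.dom p.c p.so p.ε p.η x g‖ ^ 2 + p.η ^ 2 * ‖g‖ ^ 2 := by
  have hproj := pow_le_pow_left₀ (norm_nonneg _)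
    (hp.norm_soip_dom_sub_comparator_le hy (x + p.η • g)) 2
  rw [norm_sub_rev, show x + p.η • g - p.comparator y = p.η • g - (p.comparator y - x) by abel,
    norm_sub_sq_real (p.η • g), norm_smul, mul_pow, real_inner_smul_left, Real.norm_eq_abs,
    sq_abs] at hproj
  rw [soogaStep]
  linarith

theorem sum_inner_comparator_sub_le (hy : y ∈ p.K) {a b : ℕ} (hab : a ≤ b) (hb : b ≤ p.T)
    (hg : ∀ t < p.T, ‖p.estimate z u o t‖ ≤ p.B₁) :
    ∑ t ∈ Finset.Ico a b, inner ℝ (p.estimate z u o t) (p.comparator y - p.iter z u o t) ≤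
      d / (2 * p.η) + p.T * p.η * p.B₁ ^ 2 / 2 := by
  have hη := hp.η_pos
  set V : ℕ → ℝ := fun t => ‖p.comparator y - p.iter z u o t‖ ^ 2
  have hstep : ∀ t ∈ Finset.Ico a b,
      2 * p.η * inner ℝ (p.estimate z u o t) (p.comparator y - p.iter z u o t) ≤
        V t - V (t + 1) + p.η ^ 2 * p.B₁ ^ 2 := fun t ht => by
    refine (hp.two_mul_inner_comparator_sub_le hy _ _).trans ?_
    gcongr
    · exact le_rfl
    · exact hg t ((Finset.mem_Ico.1 ht).2.trans_le hb)
  have htelescope : ∑ t ∈ Finset.Ico a b, (V t - V (t + 1)) = V a - V b := by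
    simpa [sub_eq_add_neg, add_comm] using Finset.sum_Ico_sub (fun t => -V t) hab
  have hsum := Finset.sum_le_sum hstep
  rw [← Finset.mul_sum, Finset.sum_add_distrib, htelescope, Finset.sum_const, Nat.card_Ico,
    nsmul_eq_mul] at hsum
  have hVa : V a ≤ d := by
    simpa using pow_le_pow_left₀ (norm_nonneg _)
      (hp.norm_sub_iter_le z u o (hp.comparator_mem hy) a) 2
  have hVb : 0 ≤ V b := sq_nonneg _
  have hcard : ((b - a : ℕ) : ℝ) * (p.η ^ 2 * p.B₁ ^ 2) ≤ p.T * (p.η ^ 2 * p.B₁ ^ 2) := by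
    gcongr
    omega
  rw [show d / (2 * p.η) + p.T * p.η * p.B₁ ^ 2 / 2 =
    (d + p.T * (p.η ^ 2 * p.B₁ ^ 2)) / (2 * p.η) by field_simp, le_div_iff₀' (by positivity)]
  linarith

variable {F f : Vec d → ℝ} {C : ℝ≥0} {M₁ : ℝ}

theorem exp_neg_one_mul_sub_action_sub_shrinkLoss_le (hf : IsDRSubmodular p.K M₁ f)
    (hF : LipschitzWith C F) (hEq : Set.EqOn f F p.K) (hy : y ∈ p.K) (t : ℕ) :
    Real.exp (-1) * f y - f (p.action z u o t) - shrinkLoss p M₁ ≤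
      (1 - Real.exp (-1)) * ∫ q, innerEstimate p F (p.comparator y - p.iter z u o t)
        (unshrink p.c p.r p.δ (p.iter z u o t)) q ∂bqndLaw.prod (uniformSphere p.L₀) := by
  have h := hp.exp_neg_one_mul_sub_le_integral_innerEstimate hf hF hEq hy
    (hp.unshrink_mem (hp.iter_mem z u o t))
  rwa [shrink_unshrink hp.r_pos hp.δ_lt] at h

end Input.Valid

end OnlineAscent

section Sampling

variable {Ω α β : Type*} [m₀ : MeasurableSpace Ω] [MeasurableSpace α] [MeasurableSpace β]
  {P : Measure Ω} [IsProbabilityMeasure P]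

theorem integral_comp_prodMk_of_indepFun {X : Ω → α} {Y : Ω → β} (hX : Measurable X)
    (hY : Measurable Y) (h : IndepFun X Y P) {G : α × β → ℝ}
    (hG : Integrable G ((P.map X).prod (P.map Y))) :
    ∫ ω, G (X ω, Y ω) ∂P = ∫ ω, ∫ b, G (X ω, b) ∂P.map Y ∂P := by
  have hlaw := h.map_prod_eq_prod_map_map hX.aemeasurable hY.aemeasurable
  rw [← integral_map (f := G) (hX.prodMk hY).aemeasurable
      (by rw [hlaw]; exact hG.aestronglyMeasurable), hlaw, integral_prod _ hG,
    integral_map hX.aemeasurable hG.integral_prod_left.aestronglyMeasurable]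

theorem integral_mul_eq_integral_mul_of_condExp_ae_eq {m : MeasurableSpace Ω} (hm : m ≤ m₀)
    {O S h : Ω → ℝ} (hS : StronglyMeasurable[m] S) (hO : Integrable O P)
    (hOS : Integrable (O * S) P) (hcond : P[O | m] =ᵐ[P] h) :
    ∫ ω, O ω * S ω ∂P = ∫ ω, h ω * S ω ∂P := by
  rw [show (fun ω => O ω * S ω) = O * S from rfl, ← integral_condExp hm]
  refine integral_congr_ae ?_
  filter_upwards [condExp_mul_of_stronglyMeasurable_right hS hOS hO, hcond] with ω hpull hω
  rw [hpull, Pi.mul_apply, hω]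

end Sampling

section Runs

variable {d : ℕ} {Ω : Type*} {p : Input d}

/-- The point `x_t` of SO-OGA in a run. -/
def iterRV (p : Input d) (Z : ℕ → Ω → ℝ) (U : ℕ → Ω → Vec d) (O : ℕ → Ω → ℝ) (t : ℕ) (ω : Ω) :
    Vec d :=
  p.iter (fun s => Z s ω) (fun s => U s ω) (fun s => O s ω) t

/-- The gradient estimate of round `t` in a run. -/
def estimateRV (p : Input d) (Z : ℕ → Ω → ℝ) (U : ℕ → Ω → Vec d) (O : ℕ → Ω → ℝ) (t : ℕ) (ω : Ω) :
    Vec d :=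
  p.estimate (fun s => Z s ω) (fun s => U s ω) (fun s => O s ω) t

section Measurability

variable (Z : ℕ → Ω → ℝ) (U : ℕ → Ω → Vec d) (O : ℕ → Ω → ℝ)

theorem pastSigma_mono : Monotone (pastSigma Z U O) :=
  fun _ _ hst => iSup_mono fun _ => iSup_mono' fun h => ⟨h.trans_le hst, le_rfl⟩

theorem measurable_pastSigma {s t : ℕ} (hst : s < t) :
    Measurable[pastSigma Z U O t] fun ω => (Z s ω, U s ω, O s ω) :=
  (comap_measurable _).mono (le_iSup₂_of_le s hst le_rfl) le_rfl

theorem continuous_bqndOutput (p : Input d) : Continuous fun a : Vec d × ℝ × Vec d × ℝ =>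
    bqndOutput p.c p.r p.δ a.2.1 a.1 ((p.k / p.δ * a.2.2.2) • a.2.2.1) := by
  unfold bqndOutput
  fun_prop

theorem Input.Valid.measurable_soogaStep (hp : p.Valid) :
    Measurable fun a : Vec d × ℝ × Vec d × ℝ => soogaStep p.dom p.c p.so p.ε p.η a.1
      (bqndOutput p.c p.r p.δ a.2.1 a.1 ((p.k / p.δ * a.2.2.2) • a.2.2.1)) :=
  hp.measurable_soip_dom.comp
    (continuous_fst.add ((continuous_bqndOutput p).fun_const_smul p.η)).measurable

theorem Input.Valid.measurable_iterRV (hp : p.Valid) (t : ℕ) :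
    Measurable[pastSigma Z U O t] (iterRV p Z U O t) := by
  induction t with
  | zero => exact measurable_const
  | succ t ih =>
    have hstate : Measurable[pastSigma Z U O (t + 1)]
        fun ω => (iterRV p Z U O t ω, Z t ω, U t ω, O t ω) :=
      (ih.mono (pastSigma_mono Z U O t.le_succ) le_rfl).prodMk
        (measurable_pastSigma Z U O t.lt_succ_self)
    have hstep := hp.measurable_soogaStep.comp hstate
    exact hstep

end Measurability

variable [m₀ : MeasurableSpace Ω] {f : ℕ → Vec d → ℝ} {P : Measure Ω} {Z : ℕ → Ω → ℝ}
  {U : ℕ → Ω → Vec d} {O : ℕ → Ω → ℝ}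

namespace IsRun

variable (hR : IsRun p f P Z U O) {t : ℕ}
include hR

theorem pastSigma_le (ht : t ≤ p.T) : pastSigma Z U O t ≤ m₀ :=
  iSup₂_le fun s hs => Measurable.comap_le
    ((hR.measurable_Z s (hs.trans_le ht)).prodMk
      ((hR.measurable_U s (hs.trans_le ht)).prodMk (hR.measurable_O s (hs.trans_le ht))))

theorem measurable_sample (ht : t < p.T) : Measurable fun ω => (Z t ω, U t ω) :=
  (hR.measurable_Z t ht).prodMk (hR.measurable_U t ht)

variable (hp : p.Valid)
include hp

theorem measurable_iterRV (ht : t ≤ p.T) : Measurable (iterRV p Z U O t) :=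
  (hp.measurable_iterRV Z U O t).mono (hR.pastSigma_le ht) le_rfl

theorem measurable_estimateRV (ht : t < p.T) : Measurable (estimateRV p Z U O t) :=
  (continuous_bqndOutput p).measurable.comp ((hR.measurable_iterRV hp ht.le).prodMk
    ((hR.measurable_Z t ht).prodMk ((hR.measurable_U t ht).prodMk (hR.measurable_O t ht))))

theorem ae_sample : ∀ᵐ ω ∂P, ∀ t < p.T,
    Z t ω ∈ Set.Icc (0 : ℝ) 1 ∧ U t ω ∈ p.L₀ ∧ ‖U t ω‖ = 1 := by
  have := hp.nontrivial_L₀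
  refine ae_all_iff.2 fun t => Filter.eventually_imp_distrib_left.2 fun ht => ?_
  have hlaw := ae_bqndLaw_prod_uniformSphere p.L₀
  rw [← hR.law t ht] at hlaw
  exact ae_of_ae_map (hR.measurable_sample ht).aemeasurable hlaw

theorem ae_mem :
    ∀ᵐ ω ∂P, ∀ t < p.T, actionRV p Z U O t ω ∈ p.K ∧ queryRV p Z U O t ω ∈ p.K := by
  filter_upwards [hR.ae_sample hp] with ω hω t ht
  obtain ⟨hz, hu, hu1⟩ := hω t ht
  exact ⟨hp.action_mem _ _ _ t, hp.query_mem _ hz hu hu1.le⟩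

theorem ae_norm_estimateRV_le : ∀ᵐ ω ∂P, ∀ t < p.T, ‖estimateRV p Z U O t ω‖ ≤ p.B₁ := by
  have hbounded : ∀ᵐ ω ∂P, ∀ t < p.T, |O t ω| ≤ p.B₀ :=
    ae_all_iff.2 fun t => Filter.eventually_imp_distrib_left.2 (hR.bounded t)
  filter_upwards [hR.ae_sample hp, hbounded] with ω hω ho t ht
  exact hp.norm_estimate_le (hω t ht).1 (hω t ht).2.2 (ho t ht)

theorem indepFun_iterRV_sample (ht : t < p.T) :
    IndepFun (iterRV p Z U O t) (fun ω => (Z t ω, U t ω)) P := by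
  rw [IndepFun_iff_Indep]
  exact (indep_of_indep_of_le_right (hR.indep t ht)
    (hp.measurable_iterRV Z U O t).comap_le).symm

variable [IsProbabilityMeasure P] {F : Vec d → ℝ} {y : Vec d}

theorem integrable_action (ht : t < p.T) (hF : Continuous F) (hEq : Set.EqOn (f t) F p.K) :
    Integrable (fun ω => f t (actionRV p Z U O t ω)) P := by
  have hmem : ∀ ω, actionRV p Z U O t ω ∈ p.K := fun ω => hp.action_mem _ _ _ t
  obtain ⟨B, hB⟩ := hp.isCompact.exists_bound_of_continuousOn hF.continuousOn
  have hplay : Continuous fun x : Vec d => F (hShrunk p.c p.r p.δ 1 x) := by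
    unfold hShrunk
    fun_prop
  simp only [hEq (hmem _)]
  exact Integrable.of_bound (C := B)
    (hplay.measurable.comp (hR.measurable_iterRV hp ht.le)).aestronglyMeasurable
    (.of_forall fun ω => hB _ (hmem ω))

theorem integrable_inner_estimateRV (ht : t < p.T) (hy : y ∈ p.K) :
    Integrable (fun ω => inner ℝ (estimateRV p Z U O t ω) (y - iterRV p Z U O t ω)) P := by
  refine Integrable.of_bound (C := p.B₁ * √d) ?_ ?_
  · exact ((hR.measurable_estimateRV hp ht).inner
      (measurable_const.sub (hR.measurable_iterRV hp ht.le))).aestronglyMeasurable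
  · filter_upwards [hR.ae_norm_estimateRV_le hp] with ω hω
    exact (norm_inner_le_norm _ _).trans (mul_le_mul (hω t ht)
      (hp.norm_sub_iter_le _ _ _ hy t) (norm_nonneg _) hp.B₁_pos.le)

/-- The answer of the value oracle may be replaced by its conditional mean, because everything else
in the inner product is determined by the past and by the samples of the round. -/
theorem integral_inner_estimateRV (ht : t < p.T) (hEq : Set.EqOn (f t) F p.K) (hy : y ∈ p.K) :
    ∫ ω, inner ℝ (estimateRV p Z U O t ω) (y - iterRV p Z U O t ω) ∂P =
      ∫ ω, innerEstimate p F (y - iterRV p Z U O t ω) (unshrink p.c p.r p.δ (iterRV p Z U O t ω))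
        (Z t ω, U t ω) ∂P := by
  set S : Ω → ℝ := fun ω => p.k / p.δ * inner ℝ (expScale (Z t ω)
    (unshrink p.c p.r p.δ (iterRV p Z U O t ω)) (U t ω)) (y - iterRV p Z U O t ω) with hSdef
  have hinner : ∀ ω, inner ℝ (estimateRV p Z U O t ω) (y - iterRV p Z U O t ω) =
      O t ω * S ω := fun ω => by
    simp only [estimateRV, Input.estimate, bqndOutput, expScale_smul, real_inner_smul_left, hSdef,
      iterRV]
    ring
  have hS : StronglyMeasurable[pastSigma Z U O t ⊔ sampleSigma Z U t] S := by
    have hcont : Continuous fun a : Vec d × ℝ × Vec d => p.k / p.δ *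
        inner ℝ (expScale a.2.1 (unshrink p.c p.r p.δ a.1) a.2.2) (y - a.1) := by fun_prop
    exact (hcont.measurable.comp
      (((hp.measurable_iterRV Z U O t).mono le_sup_left le_rfl).prodMk
        ((comap_measurable fun ω => (Z t ω, U t ω)).mono le_sup_right
          le_rfl))).stronglyMeasurable
  simp only [hinner]
  rw [integral_mul_eq_integral_mul_of_condExp_ae_eq
    (sup_le (hR.pastSigma_le ht.le) (hR.measurable_sample ht).comap_le) hS
    (Integrable.of_bound (hR.measurable_O t ht).aestronglyMeasurable p.B₀ (hR.bounded t ht))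
    ((hR.integrable_inner_estimateRV hp ht hy).congr (.of_forall hinner)) (hR.unbiased t ht)]
  refine integral_congr_ae ?_
  filter_upwards [hR.ae_mem hp] with ω hω
  rw [hEq (hω t ht).2]
  simp only [innerEstimate, hSdef, queryRV, Input.query, hShrunk, iterRV]
  ring

theorem integrable_innerEstimate_map_prod (ht : t < p.T) (hF : Continuous F) (hy : y ∈ p.K) :
    Integrable (fun a : Vec d × ℝ × Vec d =>
        innerEstimate p F (y - a.1) (unshrink p.c p.r p.δ a.1) a.2)
      ((P.map (iterRV p Z U O t)).prod (bqndLaw.prod (uniformSphere p.L₀))) := by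
  have := hp.nontrivial_L₀
  have hX := hR.measurable_iterRV hp ht.le
  obtain ⟨B, hB⟩ := hp.exists_norm_innerEstimate_le hF (isCompact_closedBall (0 : Vec d) √d)
  have hdom : ∀ᵐ x ∂P.map (iterRV p Z U O t), x ∈ p.dom :=
    (ae_map_iff hX.aemeasurable hp.isCompact_dom.isClosed.measurableSet).2
      (.of_forall fun ω => hp.iter_mem _ _ _ t)
  refine Integrable.of_bound (C := B) ?_ ?_
  · exact ((continuous_innerEstimate p hF).comp (by fun_prop :
      Continuous fun a : Vec d × ℝ × Vec d =>
        (y - a.1, unshrink p.c p.r p.δ a.1, a.2))).aestronglyMeasurable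
  · filter_upwards [Measure.quasiMeasurePreserving_fst.ae hdom,
      Measure.quasiMeasurePreserving_snd.ae (ae_bqndLaw_prod_uniformSphere p.L₀)] with a hx hq
    exact hB _ (mem_closedBall_zero_iff.2 (norm_sub_le_sqrt (hp.sub_cube hy)
      (hp.sub_cube (hp.dom_subset hx)))) _ (hp.unshrink_mem hx) a.2 hq.1 hq.2.2

theorem integral_innerEstimate (ht : t < p.T) (hF : Continuous F) (hy : y ∈ p.K) :
    ∫ ω, innerEstimate p F (y - iterRV p Z U O t ω) (unshrink p.c p.r p.δ (iterRV p Z U O t ω))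
        (Z t ω, U t ω) ∂P =
      ∫ ω, ∫ q, innerEstimate p F (y - iterRV p Z U O t ω)
        (unshrink p.c p.r p.δ (iterRV p Z U O t ω)) q ∂bqndLaw.prod (uniformSphere p.L₀) ∂P := by
  have hint := hR.integrable_innerEstimate_map_prod hp ht hF hy
  rw [← hR.law t ht] at hint ⊢
  exact integral_comp_prodMk_of_indepFun (hR.measurable_iterRV hp ht.le)
    (hR.measurable_sample ht) (hR.indepFun_iterRV_sample hp ht) hint

theorem exp_neg_one_mul_sub_integral_action_le {M₁ : ℝ} (ht : t < p.T)
    (hf : IsDRSubmodular p.K M₁ (f t)) (hy : y ∈ p.K) :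
    Real.exp (-1) * f t y - ∫ ω, f t (actionRV p Z U O t ω) ∂P - shrinkLoss p M₁ ≤
      (1 - Real.exp (-1)) * ∫ ω, inner ℝ (estimateRV p Z U O t ω)
        (p.comparator y - iterRV p Z U O t ω) ∂P := by
  obtain ⟨F, hF, hEq⟩ := hf.exists_lipschitzWith_eqOn hp.sub_cube hp.convex ⟨_, hp.c_mem⟩
  have := hp.nontrivial_L₀
  have hcomp := hp.comparator_mem hy
  have haction := hR.integrable_action hp ht hF.continuous hEq
  have hint := ((hR.integrable_innerEstimate_map_prod hp ht hF.continuous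
    hcomp).integral_prod_left.comp_measurable (hR.measurable_iterRV hp ht.le)).const_mul
    (1 - Real.exp (-1))
  have hpull : Real.exp (-1) * f t y - ∫ ω, f t (actionRV p Z U O t ω) ∂P - shrinkLoss p M₁ =
      ∫ ω, (Real.exp (-1) * f t y - f t (actionRV p Z U O t ω) - shrinkLoss p M₁) ∂P := by
    simp_rw [sub_right_comm _ _ (shrinkLoss p M₁)]
    rw [integral_sub (integrable_const _) haction]
    simp
  rw [hR.integral_inner_estimateRV hp ht hEq hcomp,
    hR.integral_innerEstimate hp ht hF.continuous hcomp, ← integral_const_mul, hpull]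
  exact integral_mono (((integrable_const _).sub haction).sub (integrable_const _)) hint
    fun ω => hp.exp_neg_one_mul_sub_action_sub_shrinkLoss_le hf hF hEq hy t

theorem sum_integral_inner_le {a b : ℕ} (hab : a ≤ b) (hb : b ≤ p.T) (hy : y ∈ p.K) :
    ∑ t ∈ Finset.Ico a b, ∫ ω, inner ℝ (estimateRV p Z U O t ω)
        (p.comparator y - iterRV p Z U O t ω) ∂P ≤
      d / (2 * p.η) + p.T * p.η * p.B₁ ^ 2 / 2 := by
  have hint : ∀ t ∈ Finset.Ico a b, Integrable (fun ω => inner ℝ (estimateRV p Z U O t ω)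
      (p.comparator y - iterRV p Z U O t ω)) P := fun t ht =>
    hR.integrable_inner_estimateRV hp ((Finset.mem_Ico.1 ht).2.trans_le hb) (hp.comparator_mem hy)
  rw [← integral_finsetSum _ hint]
  refine (integral_mono_ae (integrable_finsetSum _ hint) (integrable_const
    (d / (2 * p.η) + p.T * p.η * p.B₁ ^ 2 / 2)) ?_).trans (by simp)
  filter_upwards [hR.ae_norm_estimateRV_le hp] with ω hω
  exact hp.sum_inner_comparator_sub_le hy hab hb hω

end IsRun

end Runs

section Constants

theorem exists_pos_le_sub_of_antitoneOn {a : ℕ → ℝ} {m : ℕ} (ha : AntitoneOn a (Set.Ici m))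
    (r : ℝ) : ∃ r₀ : ℝ, 0 < r₀ ∧ ∀ n ≥ m, a n < r → r₀ ≤ r - a n := by
  classical
  by_cases h : ∃ n ≥ m, a n < r
  · obtain ⟨hm, hlt⟩ := Nat.find_spec h
    exact ⟨r - a (Nat.find h), sub_pos.2 hlt, fun n hn han =>
      sub_le_sub_left (ha hm hn (Nat.find_min' h ⟨hn, han⟩)) r⟩
  · exact ⟨1, one_pos, fun n hn han => absurd ⟨n, hn, han⟩ h⟩

theorem antitoneOn_natCast_rpow {q : ℝ} (hq : q ≤ 0) :
    AntitoneOn (fun n : ℕ => (n : ℝ) ^ q) (Set.Ici 1) := fun _ hm _ _ hmn =>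
  Real.rpow_le_rpow_of_nonpos (Nat.cast_pos.2 hm) (Nat.cast_le.2 hmn) hq

variable {d : ℕ} {p : Input d}

/-- The quantity `T^{1/4}`, in powers of which all parameters of the algorithm are expressed. -/
def Input.rootT (p : Input d) : ℝ := (p.T : ℝ) ^ (1 / 4 : ℝ)

namespace Input

variable (p)

theorem rootT_pow (n : ℕ) : p.rootT ^ n = (p.T : ℝ) ^ (n / 4 : ℝ) := by
  rw [rootT, ← Real.rpow_mul_natCast p.T.cast_nonneg, one_div_mul_eq_div]

theorem T_eq_rootT_pow : (p.T : ℝ) = p.rootT ^ 4 := by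
  rw [rootT_pow]; norm_num

theorem δ_eq : p.δ = p.rootT⁻¹ := Real.rpow_neg p.T.cast_nonneg _

theorem rpow_neg_half_eq : (p.T : ℝ) ^ (-(1 / 2) : ℝ) = (p.rootT ^ 2)⁻¹ := by
  rw [rootT_pow, ← Real.rpow_neg p.T.cast_nonneg]; norm_num

theorem ε_eq : p.ε = p.v / p.rootT ^ 2 := by
  rw [ε, rpow_neg_half_eq, div_eq_mul_inv]

theorem B₁_eq : p.B₁ = p.k * p.rootT * p.B₀ := by
  rw [B₁, δ_eq, div_inv_eq_mul]

theorem η_eq : p.η = p.v * p.rDom / (2 * p.k * p.B₀ * p.rootT ^ 3) := by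
  rw [η, rpow_neg_half_eq, B₁_eq, ← div_eq_mul_inv, div_div]
  ring_nf

theorem k_le : p.k ≤ d :=
  p.L₀.finrank_le.trans_eq (by simp)

end Input

namespace Input.Valid

variable (hp : p.Valid)
include hp

theorem one_le_rootT : 1 ≤ p.rootT :=
  Real.one_le_rpow (Nat.one_le_cast.2 hp.T_pos) (by norm_num)

theorem rDom_le : p.rDom ≤ p.r :=
  sub_le_self _ hp.δ_pos.le

theorem shrinkLoss_nonneg {M₁ : ℝ} (hM : 0 ≤ M₁) : 0 ≤ shrinkLoss p M₁ := by
  have := div_pos hp.ε_pos hp.rDom_pos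
  have := div_pos hp.δ_pos hp.r_pos
  have := hp.δ_pos
  unfold shrinkLoss
  positivity

theorem T_mul_shrinkLoss_le {M₁ r₀ : ℝ} (hM : 0 ≤ M₁) (hr₀ : 0 < r₀) (hle : r₀ ≤ p.rDom) :
    p.T * shrinkLoss p M₁ ≤ M₁ * (√d * (p.v / r₀ + 1 / p.r) + 2) * p.rootT ^ 3 := by
  have hv := hp.v_pos
  have hr := hp.r_pos
  have hR := hp.rDom_pos
  have hs1 := hp.one_le_rootT
  have := one_pos.trans_le hs1
  calc p.T * shrinkLoss p M₁
      = M₁ * (√d * (p.v / (p.rootT * p.rDom) + 1 / p.r) + 2) * p.rootT ^ 3 := by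
        rw [shrinkLoss, p.ε_eq, p.δ_eq, p.T_eq_rootT_pow]
        field_simp
    _ ≤ M₁ * (√d * (p.v / r₀ + 1 / p.r) + 2) * p.rootT ^ 3 := by
        gcongr
        exact hle.trans (le_mul_of_one_le_left hR.le hs1)

theorem div_two_mul_η_le {r₀ : ℝ} (hr₀ : 0 < r₀) (hle : r₀ ≤ p.rDom) :
    d / (2 * p.η) ≤ d * d * p.B₀ / (p.v * r₀) * p.rootT ^ 3 := by
  have hv := hp.v_pos
  have hB := hp.B₀_pos
  have hR := hp.rDom_pos
  have hk := hp.k_pos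
  have hs0 : 0 < p.rootT := one_pos.trans_le hp.one_le_rootT
  calc d / (2 * p.η) = d * p.k * p.B₀ / (p.v * p.rDom) * p.rootT ^ 3 := by
        rw [p.η_eq]
        field_simp
    _ ≤ d * d * p.B₀ / (p.v * r₀) * p.rootT ^ 3 := by
        gcongr
        exact p.k_le

theorem T_mul_η_mul_sq_le :
    p.T * p.η * p.B₁ ^ 2 / 2 ≤ p.v * p.r * d * p.B₀ / 4 * p.rootT ^ 3 := by
  have hv := hp.v_pos
  have hr := hp.r_pos
  have hB := hp.B₀_pos
  have hk := hp.k_pos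
  have hs0 : 0 < p.rootT := one_pos.trans_le hp.one_le_rootT
  calc p.T * p.η * p.B₁ ^ 2 / 2 = p.v * p.rDom * p.k * p.B₀ / 4 * p.rootT ^ 3 := by
        rw [p.η_eq, p.B₁_eq, p.T_eq_rootT_pow]
        field_simp
        norm_num
    _ ≤ p.v * p.r * d * p.B₀ / 4 * p.rootT ^ 3 := by
        gcongr
        · exact hp.rDom_le
        · exact p.k_le

end Input.Valid

end Constants

section Regret

variable {d : ℕ} {p : Input d} {M₁ r₀ : ℝ} {Ω : Type*} [MeasurableSpace Ω]
  {f : ℕ → Vec d → ℝ} {P : Measure Ω} [IsProbabilityMeasure P] {Z : ℕ → Ω → ℝ}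
  {U : ℕ → Ω → Vec d} {O : ℕ → Ω → ℝ}

/-- The constant of the regret bound, for a lower bound `r₀` on the radius `r - δ`. -/
def regretConst (d : ℕ) (r v M₁ B₀ r₀ : ℝ) : ℝ :=
  M₁ * (√d * (v / r₀ + 1 / r) + 2) + (d * d * B₀ / (v * r₀) + v * r * d * B₀ / 4)

theorem IsRun.exp_neg_one_mul_sum_sub_le (hR : IsRun p f P Z U O) (hp : p.Valid)
    (hf : ∀ t < p.T, IsDRSubmodular p.K M₁ (f t)) {a b : ℕ} (hab : a ≤ b) (hb : b ≤ p.T)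
    {y : Vec d} (hy : y ∈ p.K) :
    Real.exp (-1) * ∑ t ∈ Finset.Ico a b, f t y -
        ∑ t ∈ Finset.Ico a b, ∫ ω, f t (actionRV p Z U O t ω) ∂P ≤
      p.T * shrinkLoss p M₁ + (d / (2 * p.η) + p.T * p.η * p.B₁ ^ 2 / 2) := by
  have hM := (hf 0 hp.T_pos).nonneg_bound ⟨_, hp.c_mem⟩
  have hη := hp.η_pos
  have hsum := Finset.sum_le_sum fun t (ht : t ∈ Finset.Ico a b) =>
    have htT := (Finset.mem_Ico.1 ht).2.trans_le hb
    hR.exp_neg_one_mul_sub_integral_action_le hp htT (hf t htT) hy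
  rw [← Finset.mul_sum, Finset.sum_sub_distrib, Finset.sum_sub_distrib, ← Finset.mul_sum,
    Finset.sum_const, Nat.card_Ico, nsmul_eq_mul] at hsum
  have hlinear := (mul_le_mul_of_nonneg_left (hR.sum_integral_inner_le hp hab hb hy)
    one_sub_exp_neg_one_pos.le).trans
    (mul_le_of_le_one_left (by positivity) (sub_le_self 1 (Real.exp_pos _).le))
  have hcard : ((b - a : ℕ) : ℝ) * shrinkLoss p M₁ ≤ p.T * shrinkLoss p M₁ :=
    mul_le_mul_of_nonneg_right (Nat.cast_le.2 ((Nat.sub_le b a).trans hb))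
      (hp.shrinkLoss_nonneg hM)
  linarith

theorem IsRun.regret_Ico_le (hR : IsRun p f P Z U O) (hp : p.Valid)
    (hf : ∀ t < p.T, IsDRSubmodular p.K M₁ (f t)) (hr₀ : 0 < r₀) (hle : r₀ ≤ p.rDom)
    {a b : ℕ} (hab : a ≤ b) (hb : b ≤ p.T) :
    regret (Real.exp (-1)) p.K f P (actionRV p Z U O) (Finset.Ico a b) ≤
      regretConst d p.r p.v M₁ p.B₀ r₀ * (p.T : ℝ) ^ (3 / 4 : ℝ) := by
  have hM := (hf 0 hp.T_pos).nonneg_bound ⟨_, hp.c_mem⟩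
  calc regret (Real.exp (-1)) p.K f P (actionRV p Z U O) (Finset.Ico a b)
      ≤ p.T * shrinkLoss p M₁ + (d / (2 * p.η) + p.T * p.η * p.B₁ ^ 2 / 2) := by
        rw [regret, sub_le_iff_le_add, ← le_div_iff₀' (Real.exp_pos _)]
        refine csSup_le ((Set.nonempty_of_mem hp.c_mem).image _) ?_
        rintro _ ⟨y, hy, rfl⟩
        rw [le_div_iff₀' (Real.exp_pos _), ← sub_le_iff_le_add]
        exact hR.exp_neg_one_mul_sum_sub_le hp hf hab hb hy
    _ ≤ regretConst d p.r p.v M₁ p.B₀ r₀ * p.rootT ^ 3 := by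
        rw [regretConst, add_mul, add_mul]
        exact add_le_add (hp.T_mul_shrinkLoss_le hM hr₀ hle)
          (add_le_add (hp.div_two_mul_η_le hr₀ hle) hp.T_mul_η_mul_sq_le)
    _ = regretConst d p.r p.v M₁ p.B₀ r₀ * (p.T : ℝ) ^ (3 / 4 : ℝ) := by
        rw [p.rootT_pow, Nat.cast_ofNat]

end Regret

end DRSub

end

theorem proposition5 (d : ℕ) (r v M₁ B₀ : ℝ) (hr : 0 < r) (hv : 0 < v) (hB₀ : 0 < B₀) :
    ∃ C : ℝ, ∀ p : DRSub.Input d, p.r = r → p.v = v → p.B₀ = B₀ →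
      p.K ⊆ DRSub.unitCube d → IsClosed p.K → Convex ℝ p.K → DRSub.IsDownClosed p.K →
      p.K.Nontrivial → p.c ∈ p.K →
      Metric.closedBall p.c r ∩ (affineSpan ℝ p.K : Set (DRSub.Vec d)) ⊆ p.K →
      1 ≤ p.T → p.δ < r → p.ε < p.rDom → DRSub.IsSeparationOracle p.dom p.so →
      ∀ f : ℕ → DRSub.Vec d → ℝ, (∀ t < p.T, DRSub.IsDRSubmodular p.K M₁ (f t)) →
      ∀ (Ω : Type*) [MeasurableSpace Ω] (P : MeasureTheory.Measure Ω)
        [MeasureTheory.IsProbabilityMeasure P]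
        (Z : ℕ → Ω → ℝ) (U : ℕ → Ω → DRSub.Vec d) (O : ℕ → Ω → ℝ),
        DRSub.IsRun p f P Z U O →
        (∀ᵐ ω ∂P, ∀ t < p.T,
          DRSub.actionRV p Z U O t ω ∈ p.K ∧ DRSub.queryRV p Z U O t ω ∈ p.K) ∧
        (∀ t < p.T, MeasureTheory.Integrable (fun ω => f t (DRSub.actionRV p Z U O t ω)) P) ∧
        DRSub.staticRegret (Real.exp (-1)) p.K f P (DRSub.actionRV p Z U O) p.T
          ≤ C * (p.T : ℝ) ^ (3 / 4 : ℝ) ∧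
        DRSub.adaptiveRegret (Real.exp (-1)) p.K f P (DRSub.actionRV p Z U O) p.T
          ≤ C * (p.T : ℝ) ^ (3 / 4 : ℝ) := by
  obtain ⟨r₀, hr₀, hlow⟩ := DRSub.exists_pos_le_sub_of_antitoneOn
    (DRSub.antitoneOn_natCast_rpow (q := -(1 / 4)) (by norm_num)) r
  refine ⟨DRSub.regretConst d r v M₁ B₀ r₀, ?_⟩
  rintro p rfl rfl rfl hK hcl hcv hdown hnt hc hball hT hδ hε hso f hf Ω _ P _ Z U O hR
  have hp : p.Valid := ⟨hr, hv, hB₀, hK, hcl, hcv, hdown, hnt, hc, hball, hT, hδ, hε, hso⟩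
  have hle : r₀ ≤ p.rDom := hlow p.T hT hδ
  refine ⟨hR.ae_mem hp, fun t ht => ?_, ?_, ?_⟩
  · obtain ⟨F, hF, hEq⟩ := (hf t ht).exists_lipschitzWith_eqOn hK hcv ⟨_, hc⟩
    exact hR.integrable_action hp ht hF.continuous hEq
  · rw [DRSub.staticRegret, Finset.range_eq_Ico]
    exact hR.regret_Ico_le hp hf hr₀ hle (Nat.zero_le _) le_rfl
  · refine csSup_le ⟨_, 0, 0, le_rfl, hT, rfl⟩ ?_
    rintro _ ⟨s, e, hse, heT, rfl⟩
    rw [← Finset.Ico_add_one_right_eq_Icc]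
    exact hR.regret_Ico_le hp hf hr₀ hle (by omega) heT
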